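/- Let $T\in\mathbb N$, let $(\Omega,\mathcal F,\mathbb P)$ be a probability space with a filtration $(\mathcal F_t)$, and let $r^0_1,\dots,r^0_T>0$ be deterministic risk-free returns; put $\rho_t=\prod_{k=t}^{T-1}r^0_{k+1}$, $\rho_T=1$. Let $s_0\in\mathbb R^{N_s}$ be deterministic and let $$s_t=g(t,s_{t-1},\xi_t),\qquad r_t=f(t,s_t,\epsilon_t)\in\mathbb R^N,\qquad t=1,\dots,T,$$ with measurable $f(t,\cdot,\cdot)$, $g(t,\cdot,\cdot)$ and $\mathcal F_t$-measurable random vectors $\epsilon_t,\xi_t$. Assume that for each $t<T$ the conditional distribution of $(r_{t+1},s_{t+1})$ given $\mathcal F_t$ is its conditional distribution given $s_t$, and that almost surely, given $s_t$, $r_{t+1}$ has finite second moments and $\mathrm{Cov}[r_{t+1}\mid s_t]\succ0$. For each $t<T$ let $\mathcal A_t\subseteq\mathbb R^N$ be a nonempty closed cone (stable under multiplication by positive scalars, not necessarily convex). A policy is admissible (from time $t$ on) if, for every $k=0,\dots,T-1$ (for every $k=t,\dots,T-1$), $\pi_k$ is $\mathcal F_k$-measurable and $\pi_k\in\mathcal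 A_k$ almost surely; the shifted wealth follows $y_{k+1}=r^0_{k+1}y_k+r_{k+1}^\top\pi_k$. Define functions $d_t^\pm$ on $\mathbb R^{N_s}$ by $d_T^-=d_T^+=1$ and, for $t=T-1,\dots,0$, $$d_t^-(s)=\inf_{k\in\mathcal A_t}\mathrm E\big[(1-r_{t+1}^\top k)^2\big(d_{t+1}^-(s_{t+1})\mathbf 1_{\{r_{t+1}^\top k\le1\}}+d_{t+1}^+(s_{t+1})\mathbf 1_{\{r_{t+1}^\top k>1\}}\big)\,\big|\,s_t=s\big],$$ $$d_t^+(s)=\inf_{k\in\mathcal A_t}\mathrm E\big[(1+r_{t+1}^\top k)^2\big(d_{t+1}^-(s_{t+1})\mathbf 1_{\{r_{t+1}^\top k\le-1\}}+d_{t+1}^+(s_{t+1})\mathbf 1_{\{r_{t+1}^\top k>-1\}}\big)\,\big|\,s_t=s\big].$$ Then the following hold. (i) For almost every value $s$ of $s_t$ both infima are attained, and there are measurable maps $k_t^-,k_t^+$, $t=0,\dots,T-1$, such that for almost every value $s$ of $s_t$ the vectors $k_t^-(s)$ and $k_t^+(s)$ are minimizers in the problems defining $d_t^-(s)$ and $d_t^+(s)$,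 respectively. (ii) For any such $k_t^\pm$ and all $x_0,\lambda,b\in\mathbb R$, the policy $$\pi_t^*=r^0_{t+1}\big(-k_t^-(s_t)\,y_t\mathbf 1_{\{y_t\le0\}}+k_t^+(s_t)\,y_t\mathbf 1_{\{y_t>0\}}\big),\qquad t=0,\dots,T-1,$$ is admissible and solves the auxiliary problem $\mathcal A(\lambda,b)$: minimize $\mathrm E[y_T^2]$ over all admissible policies, where $y_0=x_0-(b+\lambda)/\rho_0$. Moreover, for every $t<T$, every $\sigma$-algebra $\mathcal G$ with $\sigma(s_t)\subseteq\mathcal G\subseteq\mathcal F_t$ and every $\mathcal G$-measurable real random variable $y_t$, the same feedback law, applied from time $t$ on, is admissible and minimizes $\mathrm E[y_T^2\mid\mathcal G]$ almost surely among all policies admissible from time $t$ on. (iii) For the same $t$, $\mathcal G$ and $y_t$, the optimal value $J_t(y_t,s_t)=\min\mathrm E[y_T^2\mid\mathcal G]$ over the policies admissible from time $t$ on is attained and equals, almost surely, $$J_t(y_t,s_t)=\rho_t^2d_t^-(s_t)\,y_t^2\mathbf 1_{\{y_t\le0\}}+\rho_t^2d_t^+(s_t)\,y_t^2\mathbf 1_{\{y_t>0\}}.$$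 -/

import Mathlib

open MeasureTheory ProbabilityTheory Filter
open scoped ENNReal Matrix

noncomputable section

namespace ConeMV

/-- Data of a discrete-time market with `N` risky assets, horizon `T`, and an observable
`Ns`-dimensional state: deterministic risk-free returns `r0`, portfolio constraint sets `A`, the maps
`f`, `g` of the factor model, its noises `ε`, `ξ`, adapted to the filtration `ℱ`, and the
initial state `s0`. -/
structure FactorMarket {Ω : Type*} {mΩ : MeasurableSpace Ω} (ℱ : Filtration ℕ mΩ)
    (N Ns Nε Nξ : ℕ) where
  T : ℕ
  r0 : ℕ → ℝ
  A : ℕ → Set (Fin N → ℝ)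
  f : ℕ → (Fin Ns → ℝ) → (Fin Nε → ℝ) → (Fin N → ℝ)
  measurable_f : ∀ t, Measurable (Function.uncurry (f t))
  g : ℕ → (Fin Ns → ℝ) → (Fin Nξ → ℝ) → (Fin Ns → ℝ)
  measurable_g : ∀ t, Measurable (Function.uncurry (g t))
  s0 : Fin Ns → ℝ
  ε : ℕ → Ω → (Fin Nε → ℝ)
  measurable_ε : ∀ t, Measurable[ℱ t] (ε t)
  ξ : ℕ → Ω → (Fin Nξ → ℝ)
  measurable_ξ : ∀ t, Measurable[ℱ t] (ξ t)

/-- A nonempty closed cone, not necessarily convex. -/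
structure IsClosedCone {N : ℕ} (C : Set (Fin N → ℝ)) : Prop where
  nonempty : C.Nonempty
  isClosed : IsClosed C
  smul_mem : ∀ α : ℝ, 0 < α → ∀ x ∈ C, α • x ∈ C

namespace FactorMarket

variable {Ω : Type*} {mΩ : MeasurableSpace Ω} {ℱ : Filtration ℕ mΩ} {N Ns Nε Nξ : ℕ}

/-- The state process: `s_0` is given and `s_{t+1} = g(t+1, s_t, ξ_{t+1})`. -/
def state (M : FactorMarket ℱ N Ns Nε Nξ) : ℕ → Ω → (Fin Ns → ℝ)
  | 0 => fun _ => M.s0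
  | t + 1 => fun ω => M.g (t + 1) (M.state t ω) (M.ξ (t + 1) ω)

/-- The excess returns `r_t = f(t, s_t, ε_t)`. -/
def ret (M : FactorMarket ℱ N Ns Nε Nξ) (t : ℕ) (ω : Ω) : Fin N → ℝ :=
  M.f t (M.state t ω) (M.ε t ω)

/-- The pair `(r_t, s_t)`. -/
def obs (M : FactorMarket ℱ N Ns Nε Nξ) (t : ℕ) (ω : Ω) : (Fin N → ℝ) × (Fin Ns → ℝ) :=
  (M.ret t ω, M.state t ω)

/-- The σ-algebra generated by `s_t`. -/
abbrev stateSigma (M : FactorMarket ℱ N Ns Nε Nξ) (t : ℕ) : MeasurableSpace Ω :=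
  MeasurableSpace.comap (M.state t) inferInstance

/-- `ρ_t = r⁰_{t+1} ⋯ r⁰_T`, with `ρ_T = 1`. -/
def rho (M : FactorMarket ℱ N Ns Nε Nξ) (t : ℕ) : ℝ :=
  ∏ k ∈ Finset.Ico t M.T, M.r0 (k + 1)

/-- The regular conditional distribution of `(r_{t+1}, s_{t+1})` given `s_t = s`. -/
def trans (M : FactorMarket ℱ N Ns Nε Nξ) (μ : Measure Ω) [IsFiniteMeasure μ] (t : ℕ) :
    Kernel (Fin Ns → ℝ) ((Fin N → ℝ) × (Fin Ns → ℝ)) :=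
  condDistrib (M.obs (t + 1)) (M.state t) μ

/-- The current state carries all the information in `ℱ t` about the next observation: conditional
probabilities of `(r_{t+1}, s_{t+1})` given `ℱ t` and given `s_t` coincide. -/
def IsMarkov (M : FactorMarket ℱ N Ns Nε Nξ) (μ : Measure Ω) : Prop :=
  ∀ t < M.T, ∀ B : Set ((Fin N → ℝ) × (Fin Ns → ℝ)), MeasurableSet B →
    μ⟦M.obs (t + 1) ⁻¹' B | ℱ t⟧ =ᵐ[μ] μ⟦M.obs (t + 1) ⁻¹' B | M.stateSigma t⟧

/-- The conditional covariance matrix `Cov[r_{t+1} | s_t = s]`. -/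
def condCov (M : FactorMarket ℱ N Ns Nε Nξ) (μ : Measure Ω) [IsFiniteMeasure μ] (t : ℕ)
    (s : Fin Ns → ℝ) : Matrix (Fin N) (Fin N) ℝ :=
  Matrix.of fun i j => cov[fun z => z.1 i, fun z => z.1 j; M.trans μ t s]

/-- Almost surely, `r_{t+1}` has finite second moments given `s_t` and its conditional covariance
matrix is positive definite. -/
def IsNondegenerate (M : FactorMarket ℱ N Ns Nε Nξ) (μ : Measure Ω) [IsFiniteMeasure μ] : Prop :=
  ∀ t < M.T, ∀ᵐ s ∂(μ.map (M.state t)),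
    (∀ i, MemLp (fun z : (Fin N → ℝ) × (Fin Ns → ℝ) => z.1 i) 2 (M.trans μ t s)) ∧
      (M.condCov μ t s).PosDef

end FactorMarket

/-- `E[(1 - rᵀk)² (d⁻(s) 1{rᵀk ≤ 1} + d⁺(s) 1{rᵀk > 1})]` for `(r, s)` of law `ν`. -/
def objMinus {N Ns : ℕ} (ν : Measure ((Fin N → ℝ) × (Fin Ns → ℝ)))
    (dm dp : (Fin Ns → ℝ) → ℝ) (k : Fin N → ℝ) : ℝ :=
  ∫ z, (1 - z.1 ⬝ᵥ k) ^ 2 *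
    ((if z.1 ⬝ᵥ k ≤ 1 then dm z.2 else 0) + (if 1 < z.1 ⬝ᵥ k then dp z.2 else 0)) ∂ν

/-- `E[(1 + rᵀk)² (d⁻(s) 1{rᵀk ≤ -1} + d⁺(s) 1{rᵀk > -1})]` for `(r, s)` of law `ν`. -/
def objPlus {N Ns : ℕ} (ν : Measure ((Fin N → ℝ) × (Fin Ns → ℝ)))
    (dm dp : (Fin Ns → ℝ) → ℝ) (k : Fin N → ℝ) : ℝ :=
  ∫ z, (1 + z.1 ⬝ᵥ k) ^ 2 *
    ((if z.1 ⬝ᵥ k ≤ -1 then dm z.2 else 0) + (if -1 < z.1 ⬝ᵥ k then dp z.2 else 0)) ∂ν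

namespace FactorMarket

variable {Ω : Type*} {mΩ : MeasurableSpace Ω} {ℱ : Filtration ℕ mΩ} {N Ns Nε Nξ : ℕ}

/-- The pair `(d⁻, d⁺)` when `n` periods remain, that is at time `T - n`. -/
def fio (M : FactorMarket ℱ N Ns Nε Nξ) (μ : Measure Ω) [IsFiniteMeasure μ] :
    ℕ → ((Fin Ns → ℝ) → ℝ) × ((Fin Ns → ℝ) → ℝ)
  | 0 => (fun _ => 1, fun _ => 1)
  | n + 1 =>
    (fun s => sInf (objMinus (M.trans μ (M.T - (n + 1)) s) (M.fio μ n).1 (M.fio μ n).2 ''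
        M.A (M.T - (n + 1))),
     fun s => sInf (objPlus (M.trans μ (M.T - (n + 1)) s) (M.fio μ n).1 (M.fio μ n).2 ''
        M.A (M.T - (n + 1))))

/-- `d_t⁻(s)`. -/
def dMinus (M : FactorMarket ℱ N Ns Nε Nξ) (μ : Measure Ω) [IsFiniteMeasure μ] (t : ℕ) :
    (Fin Ns → ℝ) → ℝ :=
  (M.fio μ (M.T - t)).1

/-- `d_t⁺(s)`. -/
def dPlus (M : FactorMarket ℱ N Ns Nε Nξ) (μ : Measure Ω) [IsFiniteMeasure μ] (t : ℕ) :
    (Fin Ns → ℝ) → ℝ :=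
  (M.fio μ (M.T - t)).2

/-- `d_T⁻ = 1`. -/
theorem dMinus_terminal (M : FactorMarket ℱ N Ns Nε Nξ) (μ : Measure Ω) [IsFiniteMeasure μ]
    (s : Fin Ns → ℝ) : M.dMinus μ M.T s = 1 := by
  simp [dMinus, fio]

/-- `d_T⁺ = 1`. -/
theorem dPlus_terminal (M : FactorMarket ℱ N Ns Nε Nξ) (μ : Measure Ω) [IsFiniteMeasure μ]
    (s : Fin Ns → ℝ) : M.dPlus μ M.T s = 1 := by
  simp [dPlus, fio]

/-- The backward recursion for `d⁻`. -/
theorem dMinus_step (M : FactorMarket ℱ N Ns Nε Nξ) (μ : Measure Ω) [IsFiniteMeasure μ]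
    {t : ℕ} (ht : t < M.T) (s : Fin Ns → ℝ) :
    M.dMinus μ t s = sInf (
      objMinus (M.trans μ t s) (M.dMinus μ (t + 1)) (M.dPlus μ (t + 1)) '' M.A t) := by
  obtain ⟨n, hn⟩ : ∃ n, M.T - t = n + 1 := ⟨M.T - t - 1, by omega⟩
  have h1 : M.T - (t + 1) = n := by omega
  have h2 : M.T - (n + 1) = t := by omega
  simp only [dMinus, dPlus, hn, h1, fio, h2]

/-- The backward recursion for `d⁺`. -/
theorem dPlus_step (M : FactorMarket ℱ N Ns Nε Nξ) (μ : Measure Ω) [IsFiniteMeasure μ]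
    {t : ℕ} (ht : t < M.T) (s : Fin Ns → ℝ) :
    M.dPlus μ t s = sInf (
      objPlus (M.trans μ t s) (M.dMinus μ (t + 1)) (M.dPlus μ (t + 1)) '' M.A t) := by
  obtain ⟨n, hn⟩ : ∃ n, M.T - t = n + 1 := ⟨M.T - t - 1, by omega⟩
  have h1 : M.T - (t + 1) = n := by omega
  have h2 : M.T - (n + 1) = t := by omega
  simp only [dMinus, dPlus, hn, h1, fio, h2]

/-- `km`, `kp` are measurable selections `k_t⁻(s)`, `k_t⁺(s)` of minimizers over the cone `A_t` of
the problems that define `d_t⁻(s)` and `d_t⁺(s)`, for almost every value `s` of `s_t`. -/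
structure IsMinimizer (M : FactorMarket ℱ N Ns Nε Nξ) (μ : Measure Ω) [IsFiniteMeasure μ]
    (km kp : ℕ → (Fin Ns → ℝ) → (Fin N → ℝ)) : Prop where
  measurable_minus : ∀ t < M.T, Measurable (km t)
  measurable_plus : ∀ t < M.T, Measurable (kp t)
  minus : ∀ t < M.T, ∀ᵐ s ∂(μ.map (M.state t)), km t s ∈ M.A t ∧
    IsMinOn (objMinus (M.trans μ t s) (M.dMinus μ (t + 1)) (M.dPlus μ (t + 1))) (M.A t) (km t s)
  plus : ∀ t < M.T, ∀ᵐ s ∂(μ.map (M.state t)), kp t s ∈ M.A t ∧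
    IsMinOn (objPlus (M.trans μ t s) (M.dMinus μ (t + 1)) (M.dPlus μ (t + 1))) (M.A t) (kp t s)

/-- Admissible policies on the periods `t₀, …, T - 1`: adapted and valued in the cones. -/
def IsAdmissible (M : FactorMarket ℱ N Ns Nε Nξ) (μ : Measure Ω) (t₀ : ℕ)
    (π : ℕ → Ω → (Fin N → ℝ)) : Prop :=
  ∀ t, t₀ ≤ t → t < M.T → Measurable[ℱ t] (π t) ∧ ∀ᵐ ω ∂μ, π t ω ∈ M.A t

/-- Shifted wealth started from `Y` at time `t₀`: `y_{t₀} = Y` and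
`y_{t+1} = r⁰_{t+1} y_t + r_{t+1}ᵀ π_t` for `t ≥ t₀` (constantly `Y` before `t₀`). -/
def wealth (M : FactorMarket ℱ N Ns Nε Nξ) (t₀ : ℕ) (Y : Ω → ℝ) (π : ℕ → Ω → (Fin N → ℝ)) :
    ℕ → Ω → ℝ
  | 0 => Y
  | t + 1 => fun ω =>
    if t₀ ≤ t then M.r0 (t + 1) * M.wealth t₀ Y π t ω + M.ret (t + 1) ω ⬝ᵥ π t ω else Y ω

/-- The random variable `y_T²`. -/
def cost (M : FactorMarket ℱ N Ns Nε Nξ) (t₀ : ℕ) (Y : Ω → ℝ) (π : ℕ → Ω → (Fin N → ℝ))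
    (ω : Ω) : ℝ≥0∞ :=
  ENNReal.ofReal (M.wealth t₀ Y π M.T ω ^ 2)

/-- The feedback law
`π_t*(y, s) = r⁰_{t+1} (-k_t⁻(s) y 1{y ≤ 0} + k_t⁺(s) y 1{y > 0})`. -/
def feedback (M : FactorMarket ℱ N Ns Nε Nξ) (km kp : ℕ → (Fin Ns → ℝ) → (Fin N → ℝ))
    (t : ℕ) (y : ℝ) (s : Fin Ns → ℝ) : Fin N → ℝ :=
  M.r0 (t + 1) • ((if y ≤ 0 then -(y • km t s) else 0) + (if 0 < y then y • kp t s else 0))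

/-- Shifted wealth started from `Y` at time `t₀` under the feedback law. -/
def feedbackWealth (M : FactorMarket ℱ N Ns Nε Nξ) (km kp : ℕ → (Fin Ns → ℝ) → (Fin N → ℝ))
    (t₀ : ℕ) (Y : Ω → ℝ) : ℕ → Ω → ℝ
  | 0 => Y
  | t + 1 => fun ω =>
    if t₀ ≤ t then
      M.r0 (t + 1) * M.feedbackWealth km kp t₀ Y t ω +
        M.ret (t + 1) ω ⬝ᵥ M.feedback km kp t (M.feedbackWealth km kp t₀ Y t ω) (M.state t ω)
    else Y ω

/-- The policy `π_t* = π_t*(y_t, s_t)` generated by the feedback law from `Y` at time `t₀`. -/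
def feedbackPolicy (M : FactorMarket ℱ N Ns Nε Nξ) (km kp : ℕ → (Fin Ns → ℝ) → (Fin N → ℝ))
    (t₀ : ℕ) (Y : Ω → ℝ) (t : ℕ) (ω : Ω) : Fin N → ℝ :=
  M.feedback km kp t (M.feedbackWealth km kp t₀ Y t ω) (M.state t ω)

/-- The initial shifted wealth `y_0 = x_0 - (b + lam) / ρ_0`. -/
def initialShifted (M : FactorMarket ℱ N Ns Nε Nξ) (x0 lam b : ℝ) : Ω → ℝ :=
  fun _ => x0 - (b + lam) / M.rho 0

/-- `π` solves the auxiliary problem: minimize `E[y_T²]` over admissible policies, where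
`y_0 = x_0 - (b + lam) / ρ_0`. -/
def SolvesAuxiliary (M : FactorMarket ℱ N Ns Nε Nξ) (μ : Measure Ω) (x0 lam b : ℝ)
    (π : ℕ → Ω → (Fin N → ℝ)) : Prop :=
  M.IsAdmissible μ 0 π ∧ ∀ π', M.IsAdmissible μ 0 π' →
    ∫⁻ ω, M.cost 0 (M.initialShifted x0 lam b) π ω ∂μ ≤
      ∫⁻ ω, M.cost 0 (M.initialShifted x0 lam b) π' ω ∂μ

/-- `π` solves the truncated problem: minimize `E[y_T² | m]` over admissible policies from
time `t` on, where `y_t = Y`. -/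
def SolvesTruncated (M : FactorMarket ℱ N Ns Nε Nξ) (μ : Measure Ω) (t : ℕ)
    (m : MeasurableSpace Ω) (Y : Ω → ℝ) (π : ℕ → Ω → (Fin N → ℝ)) : Prop :=
  M.IsAdmissible μ t π ∧ ∀ π', M.IsAdmissible μ t π' →
    μ⁻[M.cost t Y π | m] ≤ᵐ[μ] μ⁻[M.cost t Y π' | m]

/-- `V` is the (attained) optimal value of the truncated problem: minimize `E[y_T² | m]` over
admissible policies from time `t` on, where `y_t = Y`. -/
def IsTruncatedValue (M : FactorMarket ℱ N Ns Nε Nξ) (μ : Measure Ω) (t : ℕ)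
    (m : MeasurableSpace Ω) (Y : Ω → ℝ) (V : Ω → ℝ) : Prop :=
  (∀ π, M.IsAdmissible μ t π →
    (fun ω => ENNReal.ofReal (V ω)) ≤ᵐ[μ] μ⁻[M.cost t Y π | m]) ∧
  ∃ π, M.IsAdmissible μ t π ∧
    (fun ω => ENNReal.ofReal (V ω)) =ᵐ[μ] μ⁻[M.cost t Y π | m]

/-- `ρ_t² d_t⁻(s) y² 1{y ≤ 0} + ρ_t² d_t⁺(s) y² 1{y > 0}`. -/
def valueFormula (M : FactorMarket ℱ N Ns Nε Nξ) (μ : Measure Ω) [IsFiniteMeasure μ] (t : ℕ)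
    (y : ℝ) (s : Fin Ns → ℝ) : ℝ :=
  (if y ≤ 0 then M.rho t ^ 2 * M.dMinus μ t s * y ^ 2 else 0) +
    (if 0 < y then M.rho t ^ 2 * M.dPlus μ t s * y ^ 2 else 0)

end FactorMarket

end ConeMV

end

/-! The proof is dynamic programming, made explicit by homogeneity. With w = r⁰_{t+1} y_t, a
position k leads to y_{t+1} = r_{t+1}ᵀk + w. If the value at t + 1 is ρ²_{t+1} times a sign-weighted
square of y_{t+1}, the one-step problem is to minimize `obj` at offset w over the cone. `obj` is
jointly 2-homogeneous in position and offset, and the cone is invariant under positive scaling, so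
offset w reduces to offset ±1. These two problems define d⁻ and d⁺, and the value at t is again a
weighted square (`weightedSq_sInf_le_obj`, `weightedSq_sInf_eq_obj`).

Minimizers exist because `obj` is continuous and coercive: positive definite covariance prevents rᵀk
from being constant, and homogeneity turns positivity on a compact set into quadratic growth
(`tendsto_obj`). A lexicographic selection makes the minimizer measurable in the state
(`exists_refinement`).

Verification: by the Markov property (`lintegral_obs_succ`), the integral of the value over an event
known at time t is nondecreasing in time along any admissible policy and constant along the feedback
law. At T the value is y_T². Comparing integrals over the events of 𝒢 gives the conditional
statements. Costs are extended nonnegative, so no integrability of wealth is needed; the d^± are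
only almost everywhere measurable, so measurable versions appear throughout. -/

noncomputable section

namespace ConeMV

/-! ### Sign-weighted squares and the one-step objective -/

/-- The square of `y`, weighted by `a` for `y ≤ 0` and by `b` for `y > 0`. -/
def weightedSq (a b y : ℝ) : ℝ := y ^ 2 * if y ≤ 0 then a else b

/-- The factor y² absorbs the jump of the weight at 0; this form without cases makes continuity and
measurability immediate. -/
theorem weightedSq_eq (a b y : ℝ) : weightedSq a b y = a * (min y 0) ^ 2 + b * (max y 0) ^ 2 := by
  unfold weightedSq
  split_ifs with h
  · rw [min_eq_left h, max_eq_right h]; ring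
  · rw [min_eq_right (not_le.1 h).le, max_eq_left (not_le.1 h).le]; ring

theorem weightedSq_nonneg {a b : ℝ} (ha : 0 ≤ a) (hb : 0 ≤ b) (y : ℝ) : 0 ≤ weightedSq a b y := by
  unfold weightedSq; split_ifs <;> positivity

theorem weightedSq_le {a b : ℝ} (ha : a ≤ 1) (hb : b ≤ 1) (y : ℝ) : weightedSq a b y ≤ y ^ 2 := by
  unfold weightedSq; split_ifs <;> nlinarith [sq_nonneg y]

theorem min_mul_sq_le_weightedSq (a b y : ℝ) : min a b * y ^ 2 ≤ weightedSq a b y := by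
  unfold weightedSq
  split_ifs
  · nlinarith [sq_nonneg y, min_le_left a b]
  · nlinarith [sq_nonneg y, min_le_right a b]

theorem weightedSq_mul {c : ℝ} (hc : 0 ≤ c) (a b y : ℝ) :
    weightedSq a b (c * y) = c ^ 2 * weightedSq a b y := by
  rcases hc.eq_or_lt with rfl | hc
  · simp [weightedSq]
  · simp only [weightedSq, mul_pow, mul_assoc, mul_nonpos_iff_pos_imp_nonpos, hc, forall_const]
    congr 2
    simp [hc.le]

theorem continuous_weightedSq (a b : ℝ) : Continuous (weightedSq a b) := by
  simp_rw [funext (weightedSq_eq a b)]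
  fun_prop

theorem measurable_weightedSq : Measurable fun p : ℝ × ℝ × ℝ => weightedSq p.1 p.2.1 p.2.2 := by
  simp_rw [weightedSq_eq]
  fun_prop

/-- The common form of `objMinus` (`e = -1`) and `objPlus` (`e = 1`). -/
def obj {N Ns : ℕ} (ν : Measure ((Fin N → ℝ) × (Fin Ns → ℝ))) (dm dp : (Fin Ns → ℝ) → ℝ) (e : ℝ)
    (k : Fin N → ℝ) : ℝ :=
  ∫ z, weightedSq (dm z.2) (dp z.2) (z.1 ⬝ᵥ k + e) ∂ν

theorem objMinus_eq_obj {N Ns : ℕ} (ν : Measure ((Fin N → ℝ) × (Fin Ns → ℝ)))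
    (dm dp : (Fin Ns → ℝ) → ℝ) : objMinus ν dm dp = obj ν dm dp (-1) := by
  ext k
  refine integral_congr_ae (ae_of_all _ fun z => ?_)
  simp only [weightedSq]
  by_cases h : z.1 ⬝ᵥ k ≤ 1
  · simp only [h, not_lt.2 h, if_true, if_false]
    rw [if_pos (by linarith)]; ring
  · simp only [h, not_le.1 h, if_true, if_false]
    rw [if_neg (by linarith)]; ring

theorem objPlus_eq_obj {N Ns : ℕ} (ν : Measure ((Fin N → ℝ) × (Fin Ns → ℝ)))
    (dm dp : (Fin Ns → ℝ) → ℝ) : objPlus ν dm dp = obj ν dm dp 1 := by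
  ext k
  refine integral_congr_ae (ae_of_all _ fun z => ?_)
  simp only [weightedSq]
  by_cases h : z.1 ⬝ᵥ k ≤ -1
  · simp only [h, not_lt.2 h, if_true, if_false]
    rw [if_pos (by linarith)]; ring
  · simp only [h, not_le.1 h, if_true, if_false]
    rw [if_neg (by linarith)]; ring

/-! ### Continuity, positivity and coercivity of the objective -/

/-- A law of `(r, s)` with square integrable `r` of positive definite covariance. -/
structure IsRegularLaw {N Ns : ℕ} (ν : Measure ((Fin N → ℝ) × (Fin Ns → ℝ))) : Prop where
  memLp : ∀ i, MemLp (fun z => z.1 i) 2 ν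
  posDef : (Matrix.of fun i j => cov[fun z => z.1 i, fun z => z.1 j; ν]).PosDef

/-- A weight with values in `[0, 1]`, almost everywhere measurable and positive for the law `m`. -/
structure IsRegularWeight {Ns : ℕ} (m : Measure (Fin Ns → ℝ)) (d : (Fin Ns → ℝ) → ℝ) : Prop where
  nonneg : ∀ s, 0 ≤ d s
  le_one : ∀ s, d s ≤ 1
  aemeasurable : AEMeasurable d m
  pos : ∀ᵐ s ∂m, 0 < d s

section RegularLaw

variable {N Ns : ℕ} {ν : Measure ((Fin N → ℝ) × (Fin Ns → ℝ))}
  {a b : (Fin Ns → ℝ) → ℝ}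

theorem IsRegularWeight.aemeasurable_comp_snd (ha : IsRegularWeight ν.snd a) :
    AEMeasurable (fun z => a z.2) ν :=
  ha.aemeasurable.comp_measurable measurable_snd

theorem IsRegularWeight.ae_pos_snd (ha : IsRegularWeight ν.snd a) : ∀ᵐ z ∂ν, 0 < a z.2 :=
  ae_of_ae_map measurable_snd.aemeasurable ha.pos

theorem obj_nonneg (ha : ∀ s, 0 ≤ a s) (hb : ∀ s, 0 ≤ b s) (e : ℝ) (k : Fin N → ℝ) :
    0 ≤ obj ν a b e k :=
  integral_nonneg fun _ => weightedSq_nonneg (ha _) (hb _) _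

theorem IsRegularLaw.memLp_dotProduct (hν : IsRegularLaw ν) (k : Fin N → ℝ) :
    MemLp (fun z : (Fin N → ℝ) × (Fin Ns → ℝ) => z.1 ⬝ᵥ k) 2 ν := by
  simp only [dotProduct]
  exact memLp_finsetSum _ fun i _ => (hν.memLp i).mul_const _

theorem obj_smul {c : ℝ} (hc : 0 ≤ c) (e : ℝ) (k : Fin N → ℝ) :
    obj ν a b (c * e) (c • k) = c ^ 2 * obj ν a b e k := by
  simp only [obj, dotProduct_smul, smul_eq_mul, ← mul_add, weightedSq_mul hc, integral_const_mul]

theorem aestronglyMeasurable_weightedSq (ha : AEMeasurable (fun z => a z.2) ν)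
    (hb : AEMeasurable (fun z => b z.2) ν) (e : ℝ) (k : Fin N → ℝ) :
    AEStronglyMeasurable (fun z => weightedSq (a z.2) (b z.2) (z.1 ⬝ᵥ k + e)) ν := by
  have h : Measurable fun z : (Fin N → ℝ) × (Fin Ns → ℝ) => z.1 ⬝ᵥ k + e := by
    simp only [dotProduct]; fun_prop
  exact (measurable_weightedSq.comp_aemeasurable
    (ha.prodMk (hb.prodMk h.aemeasurable))).aestronglyMeasurable

variable [IsProbabilityMeasure ν]

theorem IsRegularLaw.memLp_affine (hν : IsRegularLaw ν) (k : Fin N → ℝ) (e : ℝ) :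
    MemLp (fun z : (Fin N → ℝ) × (Fin Ns → ℝ) => z.1 ⬝ᵥ k + e) 2 ν :=
  (hν.memLp_dotProduct k).add (memLp_const e)

theorem IsRegularLaw.integrable_weightedSq (hν : IsRegularLaw ν) (ha : IsRegularWeight ν.snd a)
    (hb : IsRegularWeight ν.snd b) (e : ℝ) (k : Fin N → ℝ) :
    Integrable (fun z => weightedSq (a z.2) (b z.2) (z.1 ⬝ᵥ k + e)) ν := by
  refine (hν.memLp_affine k e).integrable_sq.mono'
    (aestronglyMeasurable_weightedSq ha.aemeasurable_comp_snd hb.aemeasurable_comp_snd e k)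
    (ae_of_all _ fun z => ?_)
  rw [Real.norm_of_nonneg (weightedSq_nonneg (ha.nonneg _) (hb.nonneg _) _)]
  exact weightedSq_le (ha.le_one _) (hb.le_one _) _

/-- Dominated convergence on the unit ball around `p₀`. Continuity is joint in position and offset
because the compactness argument for coercivity varies both. -/
theorem IsRegularLaw.continuous_obj_prod (hν : IsRegularLaw ν) (ha : IsRegularWeight ν.snd a)
    (hb : IsRegularWeight ν.snd b) : Continuous fun p : (Fin N → ℝ) × ℝ => obj ν a b p.2 p.1 := by
  rw [continuous_iff_continuousAt]
  intro p₀
  have hL : MemLp (fun z : (Fin N → ℝ) × (Fin Ns → ℝ) =>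
      (‖p₀‖ + 1) * ∑ i, ‖z.1 i‖ + (‖p₀‖ + 1)) 2 ν :=
    ((memLp_finsetSum _ fun i _ => (hν.memLp i).norm).const_mul _).add (memLp_const _)
  refine continuousAt_of_dominated
    (bound := fun z => ((‖p₀‖ + 1) * ∑ i, ‖z.1 i‖ + (‖p₀‖ + 1)) ^ 2)
    (Eventually.of_forall fun p =>
      aestronglyMeasurable_weightedSq ha.aemeasurable_comp_snd hb.aemeasurable_comp_snd p.2 p.1) ?_
    hL.integrable_sq (ae_of_all _ fun z => ?_)
  · filter_upwards [Metric.ball_mem_nhds p₀ one_pos] with p hp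
    have hp' : ‖p‖ ≤ ‖p₀‖ + 1 := by
      have := norm_sub_norm_le p p₀
      rw [Metric.mem_ball, dist_eq_norm] at hp
      linarith
    refine ae_of_all _ fun z => ?_
    rw [Real.norm_of_nonneg (weightedSq_nonneg (ha.nonneg _) (hb.nonneg _) _)]
    refine (weightedSq_le (ha.le_one _) (hb.le_one _) _).trans ?_
    rw [← sq_abs, ← Real.norm_eq_abs]
    gcongr
    refine (norm_add_le _ _).trans (add_le_add ?_ ((norm_snd_le p).trans hp'))
    rw [dotProduct, Finset.mul_sum]
    refine norm_sum_le_of_le _ fun i _ => ?_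
    rw [norm_mul, mul_comm]
    gcongr
    exact (norm_le_pi_norm p.1 i).trans ((norm_fst_le p).trans hp')
  · refine ((continuous_weightedSq _ _).comp ?_).continuousAt
    simp only [dotProduct]
    fun_prop

theorem IsRegularLaw.continuous_obj (hν : IsRegularLaw ν) (ha : IsRegularWeight ν.snd a)
    (hb : IsRegularWeight ν.snd b) (e : ℝ) : Continuous (obj ν a b e) :=
  (hν.continuous_obj_prod ha hb).comp (f := fun k => (k, e)) (by fun_prop)

theorem IsRegularLaw.variance_dotProduct_pos (hν : IsRegularLaw ν) {k : Fin N → ℝ} (hk : k ≠ 0) :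
    0 < Var[fun z : (Fin N → ℝ) × (Fin Ns → ℝ) => z.1 ⬝ᵥ k; ν] := by
  have h := hν.posDef.dotProduct_mulVec_pos hk
  rw [← covariance_self (hν.memLp_dotProduct k).aestronglyMeasurable.aemeasurable]
  change 0 < cov[fun z => ∑ i, z.1 i * k i, fun z => ∑ i, z.1 i * k i; ν]
  rw [covariance_fun_sum_fun_sum (fun i => (hν.memLp i).mul_const _)
    (fun i => (hν.memLp i).mul_const _)]
  refine lt_of_lt_of_eq h ?_
  simp only [dotProduct, Matrix.mulVec, Finset.mul_sum, Matrix.of_apply, Pi.star_apply,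
    star_trivial]
  refine Finset.sum_congr rfl fun i _ => Finset.sum_congr rfl fun j _ => ?_
  rw [covariance_mul_const_left, covariance_mul_const_right]
  ring

theorem IsRegularLaw.not_ae_eq_const (hν : IsRegularLaw ν) {k : Fin N → ℝ} (hk : k ≠ 0) (c : ℝ) :
    ¬ ∀ᵐ z ∂ν, z.1 ⬝ᵥ k = c := by
  intro h
  have h1 := hν.variance_dotProduct_pos hk
  rw [variance_congr (Y := fun _ => c) h] at h1
  rw [← covariance_self aemeasurable_const, covariance_const_left] at h1
  exact lt_irrefl _ h1

/-- A zero objective with positive weights forces rᵀk = -e almost surely. Nondegeneracy then gives k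
= 0, hence e = 0. -/
theorem IsRegularLaw.obj_pos (hν : IsRegularLaw ν) (ha : IsRegularWeight ν.snd a)
    (hb : IsRegularWeight ν.snd b) {e : ℝ} {k : Fin N → ℝ} (h : k ≠ 0 ∨ e ≠ 0) :
    0 < obj ν a b e k := by
  refine (obj_nonneg ha.nonneg hb.nonneg e k).lt_of_ne fun h0 => ?_
  have h1 := (integral_eq_zero_iff_of_nonneg
    (fun z => weightedSq_nonneg (ha.nonneg _) (hb.nonneg _) _)
    (hν.integrable_weightedSq ha hb e k)).1 h0.symm
  have h2 : ∀ᵐ z ∂ν, z.1 ⬝ᵥ k = -e := by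
    filter_upwards [h1, ha.ae_pos_snd, hb.ae_pos_snd] with z hz hza hzb
    have h3 := min_mul_sq_le_weightedSq (a z.2) (b z.2) (z.1 ⬝ᵥ k + e)
    rw [show weightedSq (a z.2) (b z.2) (z.1 ⬝ᵥ k + e) = 0 from hz] at h3
    have h4 : (z.1 ⬝ᵥ k + e) ^ 2 = 0 :=
      le_antisymm (nonpos_of_mul_nonpos_right h3 (lt_min hza hzb)) (sq_nonneg _)
    linarith [pow_eq_zero_iff (two_ne_zero) |>.1 h4]
  by_cases hk : k = 0
  · subst hk
    obtain ⟨z, hz⟩ := h2.exists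
    simp at hz
    simp [hz] at h
  · exact hν.not_ae_eq_const hk _ h2

/-- By homogeneity, the objective at (k, e) is ‖k‖² times its value at (k/‖k‖, e/‖k‖). For ‖k‖ ≥ |e|
+ 1 this pair lies in the compact set sphere × [-1, 1], on which the objective has a positive
minimum. -/
theorem IsRegularLaw.tendsto_obj (hν : IsRegularLaw ν) (ha : IsRegularWeight ν.snd a)
    (hb : IsRegularWeight ν.snd b) (e : ℝ) :
    Tendsto (obj ν a b e) (cocompact _) atTop := by
  -- Without assets the unit sphere is empty, but the cocompact filter is trivial.
  rcases N.eq_zero_or_pos with rfl | hN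
  · simp [cocompact_eq_bot]
  have : Nonempty (Fin N) := ⟨⟨0, hN⟩⟩
  have hne : (Metric.sphere (0 : Fin N → ℝ) 1 ×ˢ Set.Icc (-1 : ℝ) 1).Nonempty := by
    have : Nontrivial (Fin N → ℝ) := Function.nontrivial (α := Fin N) (β := ℝ)
    exact (NormedSpace.sphere_nonempty.2 zero_le_one).prod ⟨0, by norm_num, by norm_num⟩
  obtain ⟨p, hp, hmin⟩ := ((isCompact_sphere (0 : Fin N → ℝ) 1).prod
    (isCompact_Icc (a := (-1 : ℝ)) (b := 1))).exists_isMinOn hne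
    (hν.continuous_obj_prod ha hb).continuousOn
  have hp0 : p.1 ≠ 0 := ne_zero_of_mem_unit_sphere ⟨p.1, hp.1⟩
  have hc := hν.obj_pos ha hb (e := p.2) (Or.inl hp0)
  refine tendsto_atTop_mono' _ (f₁ := fun k => obj ν a b p.2 p.1 * ‖k‖ ^ 2) ?_
    (((tendsto_pow_atTop two_ne_zero).comp tendsto_norm_cocompact_atTop).const_mul_atTop hc)
  filter_upwards [tendsto_norm_cocompact_atTop.eventually_ge_atTop (|e| + 1)] with k hk
  have hk0 : 0 < ‖k‖ := by linarith [abs_nonneg e]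
  have h1 : obj ν a b p.2 p.1 ≤ obj ν a b (‖k‖⁻¹ * e) (‖k‖⁻¹ • k) := by
    refine hmin (a := (‖k‖⁻¹ • k, ‖k‖⁻¹ * e)) ⟨?_, ?_⟩
    · simp [norm_smul, hk0.ne']
    · rw [Set.mem_Icc, ← abs_le, abs_mul, abs_inv, abs_norm, inv_mul_le_iff₀ hk0]
      linarith
  rw [obj_smul (by positivity), inv_pow, ← div_eq_inv_mul, le_div_iff₀ (by positivity)] at h1
  exact h1

end RegularLaw

/-! ### Measurable selection of minimizers -/

/-- A function `F s k` measurable in `s`, continuous and coercive in `k`. -/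
structure IsCoerciveIntegrand {S E : Type*} [MeasurableSpace S] [TopologicalSpace E]
    (F : S → E → ℝ) : Prop where
  measurable : ∀ k, Measurable fun s => F s k
  continuous : ∀ s, Continuous (F s)
  tendsto : ∀ s, Tendsto (F s) (cocompact E) atTop

namespace IsCoerciveIntegrand

variable {S E : Type*} [MeasurableSpace S] [TopologicalSpace E] {F : S → E → ℝ} {C : Set E}

theorem exists_isMinOn (hF : IsCoerciveIntegrand F) (hC : IsClosed C) (hne : C.Nonempty) (s : S) :
    ∃ k ∈ C, IsMinOn (F s) C k := by
  obtain ⟨k₀, hk₀⟩ := hne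
  exact (hF.continuous s).continuousOn.exists_isMinOn' hC hk₀
    (((hF.tendsto s).eventually_ge_atTop _).filter_mono inf_le_left)

theorem isCompact_sublevel [T2Space E] (hF : IsCoerciveIntegrand F) (hC : IsClosed C) (s : S)
    (c : ℝ) : IsCompact {k ∈ C | F s k ≤ c} := by
  obtain ⟨K, hK, hKc⟩ := mem_cocompact.1 ((hF.tendsto s).eventually_gt_atTop c)
  refine hK.of_isClosed_subset (hC.inter (isClosed_le (hF.continuous s) continuous_const)) ?_
  intro k hk
  by_contra hkK
  exact not_le.2 (hKc hkK) hk.2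

/-- Since minima are attained, it suffices to come within 1/(n+1) of `φ s` for every n, and by
continuity a countable dense subset of C detects this. -/
theorem measurableSet_exists_le [SecondCountableTopology E] (hF : IsCoerciveIntegrand F)
    (hC : IsClosed C) {φ : S → ℝ} (hφ : Measurable φ) :
    MeasurableSet {s | ∃ k ∈ C, F s k ≤ φ s} := by
  rcases C.eq_empty_or_nonempty with rfl | hne
  · simp
  have : Nonempty C := hne.to_subtype
  obtain ⟨u, hu⟩ := TopologicalSpace.exists_dense_seq C
  have h : {s | ∃ k ∈ C, F s k ≤ φ s} =
      ⋂ n : ℕ, ⋃ i : ℕ, {s | F s (u i) < φ s + 1 / ((n : ℝ) + 1)} := by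
    ext s
    simp only [Set.mem_ofPred_eq, Set.mem_iInter, Set.mem_iUnion]
    constructor
    · rintro ⟨k, hk, hks⟩ n
      have hopen : IsOpen {x : C | F s x < φ s + 1 / ((n : ℝ) + 1)} :=
        isOpen_lt ((hF.continuous s).comp continuous_subtype_val) continuous_const
      obtain ⟨_, hx, i, rfl⟩ := hu.inter_open_nonempty _ hopen
        ⟨⟨k, hk⟩, hks.trans_lt (lt_add_of_pos_right _ Nat.one_div_pos_of_nat)⟩
      exact ⟨i, hx⟩
    · intro h
      obtain ⟨k, hk, hmin⟩ := hF.exists_isMinOn hC hne s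
      refine ⟨k, hk, le_of_forall_pos_le_add fun δ hδ => ?_⟩
      obtain ⟨n, hn⟩ := exists_nat_one_div_lt hδ
      obtain ⟨i, hi⟩ := h n
      exact (hmin (u i).2).trans (hi.le.trans (by linarith))
  rw [h]
  exact MeasurableSet.iInter fun n => MeasurableSet.iUnion fun i =>
    measurableSet_lt (hF.measurable _) (hφ.add_const _)

theorem measurable_of_isMinOn [SecondCountableTopology E] (hF : IsCoerciveIntegrand F)
    (hC : IsClosed C) {κ : S → E} (hκ : ∀ s, κ s ∈ C) (hmin : ∀ s, IsMinOn (F s) C (κ s)) :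
    Measurable fun s => F s (κ s) := by
  refine measurable_of_Iic fun q => ?_
  convert hF.measurableSet_exists_le hC (measurable_const (a := q)) using 1
  ext s
  exact ⟨fun h => ⟨κ s, hκ s, h⟩, fun ⟨k, hk, h⟩ => (hmin s hk).trans h⟩

/-- Coordinates are fixed one at a time. Among the minimizers of G let x have the least j-th
coordinate; the penalty |k j - x j| leaves exactly the minimizers with that coordinate.
Measurability, continuity and coercivity survive, so the step can be repeated. -/
theorem exists_refinement {ι : Type*} {S : Type*} [MeasurableSpace S] [Fintype ι]
    {F : S → (ι → ℝ) → ℝ} (hF : IsCoerciveIntegrand F) {C : Set (ι → ℝ)} (hC : IsClosed C)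
    (hne : C.Nonempty) (J : Finset ι) :
    ∃ G : S → (ι → ℝ) → ℝ, IsCoerciveIntegrand G ∧
      (∀ s, ∀ k ∈ C, IsMinOn (G s) C k → IsMinOn (F s) C k) ∧
      ∀ j ∈ J, ∃ c : S → ℝ, Measurable c ∧ ∀ s, ∀ k ∈ C, IsMinOn (G s) C k → k j = c s := by
  classical
  induction J using Finset.induction_on with
  | empty => exact ⟨F, hF, fun _ _ _ h => h, by simp⟩
  | insert j J _ ih =>
    obtain ⟨G, hG, hGF, hGJ⟩ := ih
    choose κ hκ hmin using hG.exists_isMinOn hC hne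
    have hm := hG.measurable_of_isMinOn hC hκ hmin
    have hsel (s : S) : ∃ k ∈ {k ∈ C | G s k ≤ G s (κ s)},
        IsMinOn (fun k : ι → ℝ => k j) {k ∈ C | G s k ≤ G s (κ s)} k :=
      (hG.isCompact_sublevel hC s _).exists_isMinOn ⟨κ s, hκ s, le_rfl⟩
        (continuous_apply j).continuousOn
    choose x hx hxmin using hsel
    have hc : Measurable fun s => x s j := by
      refine measurable_of_Iic fun q => ?_
      -- The least coordinate is at most q exactly when the minimum over C is attained in C ∩ {k j ≤
      -- q}, a closed set that may be empty.
      convert hG.measurableSet_exists_le (C := C ∩ {k | k j ≤ q})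
        (hC.inter (isClosed_le (continuous_apply j) continuous_const)) hm using 1
      ext s
      refine ⟨fun h => ⟨x s, ⟨(hx s).1, h⟩, (hx s).2⟩, fun ⟨k, hk, h⟩ => ?_⟩
      have h1 : x s j ≤ k j := hxmin s ⟨hk.1, h⟩
      exact h1.trans hk.2
    have hkey (s : S) (k : ι → ℝ) (hk : k ∈ C)
        (h : IsMinOn (fun k => G s k + |k j - x s j|) C k) :
        IsMinOn (G s) C k ∧ k j = x s j := by
      have h1 : G s k + |k j - x s j| ≤ G s (x s) + |x s j - x s j| := h (hx s).1
      have h2 : G s (κ s) ≤ G s k := hmin s hk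
      have h3 := (hx s).2
      simp only [sub_self, abs_zero, add_zero] at h1
      have h4 := abs_nonneg (k j - x s j)
      refine ⟨fun y hy => ?_, sub_eq_zero.1 (abs_eq_zero.1 (by linarith))⟩
      have h5 : G s (κ s) ≤ G s y := hmin s hy
      change G s k ≤ G s y
      linarith
    refine ⟨fun s k => G s k + |k j - x s j|, ⟨fun k => ?_, fun s => ?_, fun s => ?_⟩,
      fun s k hk h => hGF s k hk (hkey s k hk h).1, fun i hi => ?_⟩
    · exact (hG.measurable k).add (hc.const_sub _).abs
    · have := hG.continuous s
      fun_prop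
    · exact tendsto_atTop_mono (fun k => le_add_of_nonneg_right (abs_nonneg _)) (hG.tendsto s)
    · rcases Finset.mem_insert.1 hi with rfl | hi
      · exact ⟨_, hc, fun s k hk h => (hkey s k hk h).2⟩
      · obtain ⟨c, hcm, hck⟩ := hGJ i hi
        exact ⟨c, hcm, fun s k hk h => hck s k hk (hkey s k hk h).1⟩

/-- Minimizers over a closed set can be selected measurably. -/
theorem exists_measurable_isMinOn {ι : Type*} {S : Type*} [MeasurableSpace S] [Fintype ι]
    {F : S → (ι → ℝ) → ℝ} (hF : IsCoerciveIntegrand F) {C : Set (ι → ℝ)} (hC : IsClosed C)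
    (hne : C.Nonempty) :
    ∃ κ : S → ι → ℝ, Measurable κ ∧ ∀ s, κ s ∈ C ∧ IsMinOn (F s) C (κ s) := by
  -- Once all coordinates are fixed, the minimizer of `G s` is unique, so any choice of it is
  -- measurable.
  obtain ⟨G, hG, hGF, hGJ⟩ := hF.exists_refinement hC hne Finset.univ
  choose κ hκ hmin using hG.exists_isMinOn hC hne
  refine ⟨κ, measurable_pi_lambda _ fun i => ?_, fun s => ⟨hκ s, hGF s _ (hκ s) (hmin s)⟩⟩
  obtain ⟨c, hc, hck⟩ := hGJ i (Finset.mem_univ i)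
  convert hc using 2 with s
  exact hck s _ (hκ s) (hmin s)

end IsCoerciveIntegrand

theorem IsClosedCone.zero_mem {N : ℕ} {C : Set (Fin N → ℝ)} (hC : IsClosedCone C) :
    (0 : Fin N → ℝ) ∈ C := by
  obtain ⟨x, hx⟩ := hC.nonempty
  have h : Tendsto (fun n : ℕ => (1 / ((n : ℝ) + 1)) • x) atTop (nhds ((0 : ℝ) • x)) :=
    tendsto_one_div_add_atTop_nhds_zero_nat.smul_const x
  rw [zero_smul] at h
  exact hC.isClosed.mem_of_tendsto h
    (Eventually.of_forall fun n => hC.smul_mem _ Nat.one_div_pos_of_nat _ hx)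

theorem IsMinOn.sInf_image_eq {E : Type*} {f : E → ℝ} {C : Set E} {x : E} (hx : x ∈ C)
    (h : IsMinOn f C x) : sInf (f '' C) = f x :=
  IsLeast.csInf_eq ⟨⟨x, hx, rfl⟩, by rintro _ ⟨y, hy, rfl⟩; exact h hy⟩

/-! ### Transition kernels and regularity of d⁻, d⁺ -/

namespace FactorMarket

variable {Ω : Type*} {mΩ : MeasurableSpace Ω} {ℱ : Filtration ℕ mΩ} {N Ns Nε Nξ : ℕ}
  (M : FactorMarket ℱ N Ns Nε Nξ)

theorem measurable_state (t : ℕ) : Measurable[ℱ t] (M.state t) := by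
  induction t with
  | zero => exact measurable_const
  | succ t ih =>
    exact (M.measurable_g (t + 1)).comp
      ((ih.mono (ℱ.mono t.le_succ) le_rfl).prodMk (M.measurable_ξ (t + 1)))

theorem measurable_ret (t : ℕ) : Measurable[ℱ t] (M.ret t) :=
  (M.measurable_f t).comp ((M.measurable_state t).prodMk (M.measurable_ε t))

theorem measurable_obs (t : ℕ) : Measurable[ℱ t] (M.obs t) :=
  (M.measurable_ret t).prodMk (M.measurable_state t)

variable (μ : Measure Ω) [IsProbabilityMeasure μ]

instance isMarkovKernel_trans (t : ℕ) : IsMarkovKernel (M.trans μ t) := by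
  unfold trans; infer_instance

theorem trans_comp_map_state (t : ℕ) :
    M.trans μ t ∘ₘ μ.map (M.state t) = μ.map (M.obs (t + 1)) :=
  condDistrib_comp_map ((M.measurable_state t).mono (ℱ.le t) le_rfl).aemeasurable
    ((M.measurable_obs (t + 1)).mono (ℱ.le _) le_rfl).aemeasurable

variable {μ} in
-- Mixing the transition laws over the law of s_t gives the law of (r_{t+1}, s_{t+1}), so a null set
-- of next states is null for almost every transition law.
theorem ae_trans_of_ae_state {t : ℕ} {p : (Fin Ns → ℝ) → Prop}
    (h : ∀ᵐ s ∂μ.map (M.state (t + 1)), p s) :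
    ∀ᵐ s ∂μ.map (M.state t), ∀ᵐ z ∂(M.trans μ t s), p z.2 := by
  apply Measure.ae_ae_of_ae_comp
  rw [trans_comp_map_state]
  have h1 : (μ.map (M.obs (t + 1))).map Prod.snd = μ.map (M.state (t + 1)) :=
    Measure.map_map measurable_snd ((M.measurable_obs (t + 1)).mono (ℱ.le _) le_rfl)
  rw [← h1] at h
  exact ae_of_ae_map measurable_snd.aemeasurable h

variable {μ} in
theorem ae_snd_trans_of_ae_state {t : ℕ} {p : (Fin Ns → ℝ) → Prop}
    (h : ∀ᵐ s ∂μ.map (M.state (t + 1)), p s) :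
    ∀ᵐ s ∂μ.map (M.state t), ∀ᵐ x ∂(M.trans μ t s).snd, p x := by
  -- Passing to a marginal needs a measurable set, and `p` need not define one.
  obtain ⟨G, hG, hGm, hGp⟩ := h.exists_measurable_mem
  filter_upwards [M.ae_trans_of_ae_state (p := (· ∈ G)) hG] with s hs
  filter_upwards [(ae_map_iff measurable_snd.aemeasurable hGm).2 hs] with x hx using hGp x hx

variable {M μ} in
theorem ae_isRegularWeight_trans {t : ℕ} {d : (Fin Ns → ℝ) → ℝ}
    (h : IsRegularWeight (μ.map (M.state (t + 1))) d) :
    ∀ᵐ s ∂μ.map (M.state t), IsRegularWeight (M.trans μ t s).snd d := by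
  filter_upwards [M.ae_snd_trans_of_ae_state h.pos,
    M.ae_snd_trans_of_ae_state h.aemeasurable.ae_eq_mk] with s h1 h2
  exact ⟨h.nonneg, h.le_one, ⟨_, h.aemeasurable.measurable_mk, h2⟩, h1⟩

variable {M μ} in
theorem IsNondegenerate.ae_isRegularLaw (h : M.IsNondegenerate μ) {t : ℕ} (ht : t < M.T) :
    ∀ᵐ s ∂μ.map (M.state t), IsRegularLaw (M.trans μ t s) := by
  filter_upwards [h t ht] with s hs using ⟨hs.1, hs.2⟩

theorem measurable_obj_trans (t : ℕ) {a b : (Fin Ns → ℝ) → ℝ} (ha : Measurable a)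
    (hb : Measurable b) (e : ℝ) (k : Fin N → ℝ) :
    Measurable fun s => obj (M.trans μ t s) a b e k := by
  have h : Measurable fun z : (Fin N → ℝ) × (Fin Ns → ℝ) => z.1 ⬝ᵥ k + e := by
    simp only [dotProduct]; fun_prop
  have h' := measurable_weightedSq.comp
    ((ha.comp measurable_snd).prodMk ((hb.comp measurable_snd).prodMk h))
  exact (StronglyMeasurable.integral_kernel (κ := M.trans μ t) h'.stronglyMeasurable).measurable

variable {M μ} in
theorem IsNondegenerate.exists_measurable_isMinOn_obj (hM : M.IsNondegenerate μ) {t : ℕ}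
    (ht : t < M.T) (hA : IsClosedCone (M.A t)) {a b : (Fin Ns → ℝ) → ℝ}
    (ha : IsRegularWeight (μ.map (M.state (t + 1))) a)
    (hb : IsRegularWeight (μ.map (M.state (t + 1))) b) (e : ℝ) :
    ∃ κ : (Fin Ns → ℝ) → (Fin N → ℝ), Measurable κ ∧
      AEMeasurable (fun s => obj (M.trans μ t s) a b e (κ s)) (μ.map (M.state t)) ∧
      ∀ᵐ s ∂μ.map (M.state t), κ s ∈ M.A t ∧
        IsMinOn (obj (M.trans μ t s) a b e) (M.A t) (κ s) := by
  classical
  set a' := ha.aemeasurable.mk a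
  set b' := hb.aemeasurable.mk b
  have hgood : ∀ᵐ s ∂μ.map (M.state t), Continuous (obj (M.trans μ t s) a b e) ∧
      Tendsto (obj (M.trans μ t s) a b e) (cocompact _) atTop ∧
      obj (M.trans μ t s) a b e = obj (M.trans μ t s) a' b' e := by
    filter_upwards [hM.ae_isRegularLaw ht, ae_isRegularWeight_trans ha,
      ae_isRegularWeight_trans hb, M.ae_trans_of_ae_state ha.aemeasurable.ae_eq_mk,
      M.ae_trans_of_ae_state hb.aemeasurable.ae_eq_mk] with s hs has hbs has' hbs'
    refine ⟨hs.continuous_obj has hbs e, hs.tendsto_obj has hbs e, funext fun k => ?_⟩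
    refine integral_congr_ae ?_
    filter_upwards [has', hbs'] with z hz1 hz2
    rw [hz1, hz2]
  obtain ⟨G, hG, hGm, hGp⟩ := hgood.exists_measurable_mem
  -- Measurable weights and the harmless coercive value ‖k‖ off the good set make the integrand
  -- regular for every s, not just almost every s.
  let F : (Fin Ns → ℝ) → (Fin N → ℝ) → ℝ := fun s k =>
    if s ∈ G then obj (M.trans μ t s) a' b' e k else ‖k‖
  have hF : IsCoerciveIntegrand F := by
    refine ⟨fun k => ?_, fun s => ?_, fun s => ?_⟩
    · exact (M.measurable_obj_trans μ t ha.aemeasurable.measurable_mk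
        hb.aemeasurable.measurable_mk e k).ite hGm measurable_const
    · by_cases hs : s ∈ G
      · simpa only [F, hs, if_true, ← (hGp s hs).2.2] using (hGp s hs).1
      · simpa only [F, hs, if_false] using continuous_norm
    · by_cases hs : s ∈ G
      · simpa only [F, hs, if_true, ← (hGp s hs).2.2] using (hGp s hs).2.1
      · simpa only [F, hs, if_false] using tendsto_norm_cocompact_atTop
  obtain ⟨κ, hκm, hκ⟩ := hF.exists_measurable_isMinOn hA.isClosed hA.nonempty
  have hFG (s) (hs : s ∈ G) : F s = obj (M.trans μ t s) a b e := by
    rw [(hGp s hs).2.2]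
    ext k
    simp only [F, hs, if_true]
  refine ⟨κ, hκm, ⟨fun s => F s (κ s),
    hF.measurable_of_isMinOn hA.isClosed (fun s => (hκ s).1) fun s => (hκ s).2, ?_⟩, ?_⟩
  · filter_upwards [hG] with s hs
    rw [hFG s hs]
  · filter_upwards [hG] with s hs
    rw [← hFG s hs]
    exact hκ s

variable {M μ} in
-- The competitor k = 0 gives the bound 1, and positivity comes from attainment together with
-- `obj_pos`.
theorem IsNondegenerate.isRegularWeight_sInf_obj (hM : M.IsNondegenerate μ) {t : ℕ}
    (ht : t < M.T) (hA : IsClosedCone (M.A t)) {a b : (Fin Ns → ℝ) → ℝ}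
    (ha : IsRegularWeight (μ.map (M.state (t + 1))) a)
    (hb : IsRegularWeight (μ.map (M.state (t + 1))) b) {e : ℝ} (he : e ^ 2 = 1) :
    IsRegularWeight (μ.map (M.state t))
      fun s => sInf (obj (M.trans μ t s) a b e '' M.A t) := by
  obtain ⟨κ, -, hκm, hκ⟩ := hM.exists_measurable_isMinOn_obj ht hA ha hb e
  have hnn (s k) : 0 ≤ obj (M.trans μ t s) a b e k := obj_nonneg ha.nonneg hb.nonneg e k
  refine ⟨fun s => ?_, fun s => ?_, hκm.congr ?_, ?_⟩
  · apply Real.sInf_nonneg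
    rintro _ ⟨k, -, rfl⟩
    exact hnn s k
  · refine (csInf_le ⟨0, ?_⟩ (Set.mem_image_of_mem _ hA.zero_mem)).trans ?_
    · rintro _ ⟨k, -, rfl⟩
      exact hnn s k
    -- Only the constant bound has to be integrable here, so the estimate holds for every s,
    -- exceptional ones included.
    · refine (integral_mono_of_nonneg
        (ae_of_all _ fun z => weightedSq_nonneg (ha.nonneg _) (hb.nonneg _) _)
        (integrable_const (1 : ℝ)) (ae_of_all _ fun z => ?_)).trans (by simp)
      refine (weightedSq_le (ha.le_one _) (hb.le_one _) _).trans ?_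
      simp [he]
  · filter_upwards [hκ] with s hs
    rw [IsMinOn.sInf_image_eq hs.1 hs.2]
  · filter_upwards [hκ, hM.ae_isRegularLaw ht, ae_isRegularWeight_trans ha,
      ae_isRegularWeight_trans hb] with s hs hs1 has hbs
    rw [IsMinOn.sInf_image_eq hs.1 hs.2]
    exact hs1.obj_pos has hbs (Or.inr (by rintro rfl; simp at he))

variable {M μ} in
theorem IsNondegenerate.isRegularWeight_dMinus_dPlus (hM : M.IsNondegenerate μ)
    (hA : ∀ t < M.T, IsClosedCone (M.A t)) {t : ℕ} (ht : t ≤ M.T) :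
    IsRegularWeight (μ.map (M.state t)) (M.dMinus μ t) ∧
      IsRegularWeight (μ.map (M.state t)) (M.dPlus μ t) := by
  induction ht using Nat.decreasingInduction with
  | self =>
    rw [funext (M.dMinus_terminal μ), funext (M.dPlus_terminal μ), and_self]
    exact ⟨by simp, by simp, aemeasurable_const, by simp⟩
  | of_succ t ht ih =>
    rw [funext (M.dMinus_step μ ht), funext (M.dPlus_step μ ht)]
    simp only [objMinus_eq_obj, objPlus_eq_obj]
    exact ⟨hM.isRegularWeight_sInf_obj ht (hA t ht) ih.1 ih.2 (by norm_num),
      hM.isRegularWeight_sInf_obj ht (hA t ht) ih.1 ih.2 (by norm_num)⟩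

variable {M μ} in
/-- Measurable selections of minimizers exist. -/
theorem IsNondegenerate.exists_isMinimizer (hM : M.IsNondegenerate μ)
    (hA : ∀ t < M.T, IsClosedCone (M.A t)) :
    ∃ km kp : ℕ → (Fin Ns → ℝ) → (Fin N → ℝ), M.IsMinimizer μ km kp := by
  have h (e : ℝ) (t : ℕ) : ∃ κ : (Fin Ns → ℝ) → (Fin N → ℝ), t < M.T → Measurable κ ∧
      ∀ᵐ s ∂μ.map (M.state t), κ s ∈ M.A t ∧
        IsMinOn (obj (M.trans μ t s) (M.dMinus μ (t + 1)) (M.dPlus μ (t + 1)) e) (M.A t) (κ s) := by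
    by_cases ht : t < M.T
    · have hd := hM.isRegularWeight_dMinus_dPlus hA (Nat.succ_le_of_lt ht)
      obtain ⟨κ, hκ, -, hκ'⟩ := hM.exists_measurable_isMinOn_obj ht (hA t ht) hd.1 hd.2 e
      exact ⟨κ, fun _ => ⟨hκ, hκ'⟩⟩
    · exact ⟨0, fun h => absurd h ht⟩
  choose κ hκ using h
  refine ⟨κ (-1), κ 1, fun t ht => (hκ _ t ht).1, fun t ht => (hκ _ t ht).1, fun t ht => ?_,
    fun t ht => ?_⟩
  · simpa only [objMinus_eq_obj] using (hκ _ t ht).2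
  · simpa only [objPlus_eq_obj] using (hκ _ t ht).2

end FactorMarket

/-! ### Reduction to offsets ±1 by homogeneity -/

section Cone

variable {N Ns : ℕ} {ν : Measure ((Fin N → ℝ) × (Fin Ns → ℝ))} {a b : (Fin Ns → ℝ) → ℝ}
  {C : Set (Fin N → ℝ)}

/-- For w ≠ 0, rescaling by 1/|w| keeps the position in C and turns the offset into ±1; for w = 0
the left side vanishes. -/
theorem weightedSq_sInf_le_obj (hC : IsClosedCone C) (ha : ∀ s, 0 ≤ a s) (hb : ∀ s, 0 ≤ b s)
    (w : ℝ) {k : Fin N → ℝ} (hk : k ∈ C) :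
    weightedSq (sInf (obj ν a b (-1) '' C)) (sInf (obj ν a b 1 '' C)) w ≤ obj ν a b w k := by
  have key (e c : ℝ) (hc : 0 < c) : c ^ 2 * sInf (obj ν a b e '' C) ≤ obj ν a b (c * e) k := by
    rw [← smul_inv_smul₀ hc.ne' k, obj_smul hc.le]
    gcongr
    refine csInf_le ⟨0, ?_⟩ (Set.mem_image_of_mem _ (hC.smul_mem _ (inv_pos.2 hc) _ hk))
    rintro _ ⟨k, -, rfl⟩
    exact obj_nonneg ha hb e k
  rcases lt_trichotomy w 0 with hw | rfl | hw
  · have := key (-1) (-w) (by linarith)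
    rw [neg_mul_neg, mul_one, neg_sq] at this
    rwa [weightedSq, if_pos hw.le]
  · simpa [weightedSq] using obj_nonneg ha hb 0 k
  · have := key 1 w hw
    rw [mul_one] at this
    rwa [weightedSq, if_neg (not_le.2 hw)]

theorem weightedSq_sInf_eq_obj {km kp : Fin N → ℝ} (hkm : km ∈ C)
    (hm : IsMinOn (obj ν a b (-1)) C km) (hkp : kp ∈ C) (hp : IsMinOn (obj ν a b 1) C kp) (w : ℝ) :
    weightedSq (sInf (obj ν a b (-1) '' C)) (sInf (obj ν a b 1 '' C)) w =
      obj ν a b w (if w ≤ 0 then -w • km else w • kp) := by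
  rw [IsMinOn.sInf_image_eq hkm hm, IsMinOn.sInf_image_eq hkp hp, weightedSq]
  split_ifs with hw
  · have := obj_smul (ν := ν) (a := a) (b := b) (neg_nonneg.2 hw) (-1) km
    rw [neg_mul_neg, mul_one, neg_sq] at this
    exact this.symm
  · have := obj_smul (ν := ν) (a := a) (b := b) (not_le.1 hw).le 1 kp
    rw [mul_one] at this
    exact this.symm

end Cone

/-! ### Markov property and the one-step Bellman relation -/

namespace FactorMarket

variable {Ω : Type*} {mΩ : MeasurableSpace Ω} {ℱ : Filtration ℕ mΩ} {N Ns Nε Nξ : ℕ}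
  {M : FactorMarket ℱ N Ns Nε Nξ} {μ : Measure Ω} [IsProbabilityMeasure μ]

/-- The kernel at s_t is the conditional probability given s_t, hence by the Markov property given
`ℱ t`, and may be integrated over any `ℱ t`-event. -/
theorem IsMarkov.setLIntegral_trans (hM : M.IsMarkov μ) {t : ℕ} (ht : t < M.T) {B : Set Ω}
    (hB : MeasurableSet[ℱ t] B) {D : Set ((Fin N → ℝ) × (Fin Ns → ℝ))} (hD : MeasurableSet D) :
    ∫⁻ ω in B, M.trans μ t (M.state t ω) D ∂μ = μ (B ∩ M.obs (t + 1) ⁻¹' D) := by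
  have hs : Measurable (M.state t) := (M.measurable_state t).mono (ℱ.le t) le_rfl
  have ho : Measurable (M.obs (t + 1)) := (M.measurable_obs (t + 1)).mono (ℱ.le _) le_rfl
  have h1 : (fun ω => (M.trans μ t (M.state t ω)).real D) =ᵐ[μ]
      μ⟦M.obs (t + 1) ⁻¹' D | ℱ t⟧ :=
    (condDistrib_ae_eq_condExp hs ho hD).trans (hM t ht D hD).symm
  have h2 : ∫ ω in B, (M.trans μ t (M.state t ω)).real D ∂μ =
      μ.real (B ∩ M.obs (t + 1) ⁻¹' D) := by
    rw [setIntegral_congr_ae (ℱ.le t _ hB) (h1.mono fun ω h _ => h),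
      setIntegral_condExp (ℱ.le t) ((integrable_const _).indicator (ho hD)) hB,
      integral_indicator_const _ (ho hD), measureReal_restrict_apply (ho hD), smul_eq_mul, mul_one,
      Set.inter_comm]
  have hmeas : Measurable fun ω => M.trans μ t (M.state t ω) D :=
    ((M.trans μ t).measurable_coe hD).comp hs
  simp_rw [measureReal_def] at h2
  rw [integral_toReal hmeas.aemeasurable (ae_of_all _ fun ω => measure_lt_top _ _)] at h2
  refine (ENNReal.toReal_eq_toReal_iff' (ne_of_lt ?_) (measure_ne_top _ _)).1 h2
  refine (lintegral_mono fun ω => prob_le_one).trans_lt ?_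
  simp

/-- The conditional law of the next observation given `ℱ t` is `M.trans μ t` at the current state. -/
theorem IsMarkov.lintegral_obs_succ (hM : M.IsMarkov μ) {t : ℕ} (ht : t < M.T) {E : Type*}
    [MeasurableSpace E] {X : Ω → E} (hX : Measurable[ℱ t] X)
    {Φ : E × ((Fin N → ℝ) × (Fin Ns → ℝ)) → ℝ≥0∞} (hΦ : Measurable Φ) :
    ∫⁻ ω, Φ (X ω, M.obs (t + 1) ω) ∂μ =
      ∫⁻ ω, ∫⁻ z, Φ (X ω, z) ∂(M.trans μ t (M.state t ω)) ∂μ := by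
  have hs : Measurable (M.state t) := (M.measurable_state t).mono (ℱ.le t) le_rfl
  have ho : Measurable (M.obs (t + 1)) := (M.measurable_obs (t + 1)).mono (ℱ.le _) le_rfl
  have hX' : Measurable X := hX.mono (ℱ.le t) le_rfl
  let κ := (M.trans μ t).comap (M.state t) hs
  -- Both sides are finite laws, so agreement on rectangles suffices.
  have hlaw : μ.map (fun ω => (X ω, M.obs (t + 1) ω)) = (μ ⊗ₘ κ).map (Prod.map X id) := by
    refine Measure.ext_prod fun {C D} hC hD => ?_
    rw [Measure.map_apply (hX'.prodMk ho) (hC.prod hD),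
      Measure.map_apply (hX'.prodMap measurable_id) (hC.prod hD),
      show Prod.map X id ⁻¹' C ×ˢ D = (X ⁻¹' C) ×ˢ D from rfl,
      Measure.compProd_apply_prod (hX' hC) hD]
    exact (hM.setLIntegral_trans ht (hX hC) hD).symm
  rw [← lintegral_map hΦ (hX'.prodMk ho), hlaw,
    lintegral_map hΦ (hX'.prodMap measurable_id),
    Measure.lintegral_compProd (f := fun q => Φ (Prod.map X id q))
      (hΦ.comp (hX'.prodMap measurable_id))]
  rfl

theorem rho_eq_mul {t : ℕ} (ht : t < M.T) : M.rho t = M.r0 (t + 1) * M.rho (t + 1) :=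
  Finset.prod_eq_prod_Ico_succ_bot ht _

variable (M μ) in
theorem valueFormula_eq (t : ℕ) (y : ℝ) (s : Fin Ns → ℝ) :
    M.valueFormula μ t y s = M.rho t ^ 2 * weightedSq (M.dMinus μ t s) (M.dPlus μ t s) y := by
  unfold valueFormula weightedSq
  by_cases h : y ≤ 0
  · rw [if_pos h, if_neg (not_lt.2 h), if_pos h]; ring
  · rw [if_neg h, if_pos (not_le.1 h), if_neg h]; ring

variable (M μ) in
theorem valueFormula_terminal (y : ℝ) (s : Fin Ns → ℝ) : M.valueFormula μ M.T y s = y ^ 2 := by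
  simp [valueFormula_eq, dMinus_terminal, dPlus_terminal, rho, weightedSq]

/-- The conditional expectation of the next value, on the events of `ℱ t`. -/
theorem setLIntegral_valueFormula_succ (hMarkov : M.IsMarkov μ) (hM : M.IsNondegenerate μ)
    (hA : ∀ t < M.T, IsClosedCone (M.A t)) {t : ℕ} (ht : t < M.T) {y : Ω → ℝ}
    (hy : Measurable[ℱ t] y) {p : Ω → Fin N → ℝ} (hp : Measurable[ℱ t] p) {B : Set Ω}
    (hB : MeasurableSet[ℱ t] B) :
    ∫⁻ ω in B, ENNReal.ofReal (M.valueFormula μ (t + 1)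
        (M.r0 (t + 1) * y ω + M.ret (t + 1) ω ⬝ᵥ p ω) (M.state (t + 1) ω)) ∂μ =
      ∫⁻ ω in B, ENNReal.ofReal (M.rho (t + 1) ^ 2 * obj (M.trans μ t (M.state t ω))
        (M.dMinus μ (t + 1)) (M.dPlus μ (t + 1)) (M.r0 (t + 1) * y ω) (p ω)) ∂μ := by
  have hs (u : ℕ) : Measurable (M.state u) := (M.measurable_state u).mono (ℱ.le u) le_rfl
  obtain ⟨hdm, hdp⟩ := hM.isRegularWeight_dMinus_dPlus hA (t := t + 1) ht
  set a := hdm.aemeasurable.mk _ with ha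
  set b := hdp.aemeasurable.mk _ with hb
  have ham : Measurable a := hdm.aemeasurable.measurable_mk
  have hbm : Measurable b := hdp.aemeasurable.measurable_mk
  have hae := hdm.aemeasurable.ae_eq_mk
  have hbe := hdp.aemeasurable.ae_eq_mk
  rw [← ha] at hae
  rw [← hb] at hbe
  let Φ : (ℝ≥0∞ × ℝ × (Fin N → ℝ)) × ((Fin N → ℝ) × (Fin Ns → ℝ)) → ℝ≥0∞ := fun q =>
    q.1.1 * ENNReal.ofReal (M.rho (t + 1) ^ 2 *
      weightedSq (a q.2.2) (b q.2.2) (q.2.1 ⬝ᵥ q.1.2.2 + M.r0 (t + 1) * q.1.2.1))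
  have hΦ : Measurable Φ := by
    have h1 : Measurable fun q : (ℝ≥0∞ × ℝ × (Fin N → ℝ)) × ((Fin N → ℝ) × (Fin Ns → ℝ)) =>
        q.2.1 ⬝ᵥ q.1.2.2 + M.r0 (t + 1) * q.1.2.1 := by
      simp only [dotProduct]; fun_prop
    have h2 := measurable_weightedSq.comp ((ham.comp (measurable_snd.comp measurable_snd)).prodMk
      ((hbm.comp (measurable_snd.comp measurable_snd)).prodMk h1))
    exact (measurable_fst.comp measurable_fst).mul (h2.const_mul _).ennreal_ofReal
  -- The indicator of B is carried as part of the known data, so the identity over the whole space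
  -- covers integrals over B.
  have hX : Measurable[ℱ t] fun ω => (B.indicator (fun _ => (1 : ℝ≥0∞)) ω, y ω, p ω) :=
    (measurable_const.indicator hB).prodMk (hy.prodMk hp)
  have hset (f : Ω → ℝ≥0∞) : ∫⁻ ω in B, f ω ∂μ =
      ∫⁻ ω, B.indicator (fun _ => (1 : ℝ≥0∞)) ω * f ω ∂μ := by
    rw [← lintegral_indicator (ℱ.le t _ hB)]
    refine lintegral_congr fun ω => ?_
    by_cases h : ω ∈ B <;> simp [h]
  rw [hset, hset]
  refine Eq.trans ?_ ((hMarkov.lintegral_obs_succ ht hX hΦ).trans ?_)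
  · refine lintegral_congr_ae ?_
    filter_upwards [ae_of_ae_map (hs (t + 1)).aemeasurable hae,
      ae_of_ae_map (hs (t + 1)).aemeasurable hbe] with ω h1 h2
    simp only [Φ, obs, valueFormula_eq, h1, h2]
    rw [add_comm (M.r0 (t + 1) * y ω)]
  · refine lintegral_congr_ae ?_
    filter_upwards [ae_of_ae_map (hs t).aemeasurable (M.ae_trans_of_ae_state hae),
      ae_of_ae_map (hs t).aemeasurable (M.ae_trans_of_ae_state hbe),
      ae_of_ae_map (hs t).aemeasurable (hM.ae_isRegularLaw ht),
      ae_of_ae_map (hs t).aemeasurable (ae_isRegularWeight_trans hdm),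
      ae_of_ae_map (hs t).aemeasurable (ae_isRegularWeight_trans hdp)] with ω h1 h2 h3 h4 h5
    have hne : B.indicator (fun _ => (1 : ℝ≥0∞)) ω ≠ ∞ := by
      by_cases h : ω ∈ B <;> simp [h]
    simp only [Φ]
    rw [lintegral_const_mul' _ _ hne, obj, ← integral_const_mul,
      ofReal_integral_eq_lintegral_ofReal ((h3.integrable_weightedSq h4 h5 _ _).const_mul _)
        (ae_of_all _ fun z => mul_nonneg (sq_nonneg _)
          (weightedSq_nonneg (hdm.nonneg _) (hdp.nonneg _) _))]
    congr 1
    refine lintegral_congr_ae ?_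
    filter_upwards [h1, h2] with z hz1 hz2
    rw [hz1, hz2]

/-- Since ρ_t = r⁰_{t+1} ρ_{t+1}, the factor r⁰_{t+1}² can be moved into the weighted square,
producing the offset r⁰_{t+1} y. -/
theorem valueFormula_eq_sInf {t : ℕ} (ht : t < M.T) (y : ℝ) (s : Fin Ns → ℝ) :
    M.valueFormula μ t y s = M.rho (t + 1) ^ 2 * (M.r0 (t + 1) ^ 2 * weightedSq
      (sInf (obj (M.trans μ t s) (M.dMinus μ (t + 1)) (M.dPlus μ (t + 1)) (-1) '' M.A t))
      (sInf (obj (M.trans μ t s) (M.dMinus μ (t + 1)) (M.dPlus μ (t + 1)) 1 '' M.A t)) y) := by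
  rw [valueFormula_eq, dMinus_step M μ ht, dPlus_step M μ ht, objMinus_eq_obj, objPlus_eq_obj,
    rho_eq_mul ht]
  ring

theorem setLIntegral_valueFormula_le_succ (hMarkov : M.IsMarkov μ) (hM : M.IsNondegenerate μ)
    (hr0 : ∀ t < M.T, 0 < M.r0 (t + 1)) (hA : ∀ t < M.T, IsClosedCone (M.A t)) {t : ℕ}
    (ht : t < M.T) {y : Ω → ℝ} (hy : Measurable[ℱ t] y) {p : Ω → Fin N → ℝ}
    (hp : Measurable[ℱ t] p) (hpA : ∀ᵐ ω ∂μ, p ω ∈ M.A t) {B : Set Ω}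
    (hB : MeasurableSet[ℱ t] B) :
    ∫⁻ ω in B, ENNReal.ofReal (M.valueFormula μ t (y ω) (M.state t ω)) ∂μ ≤
      ∫⁻ ω in B, ENNReal.ofReal (M.valueFormula μ (t + 1)
        (M.r0 (t + 1) * y ω + M.ret (t + 1) ω ⬝ᵥ p ω) (M.state (t + 1) ω)) ∂μ := by
  obtain ⟨hdm, hdp⟩ := hM.isRegularWeight_dMinus_dPlus hA (t := t + 1) ht
  rw [setLIntegral_valueFormula_succ hMarkov hM hA ht hy hp hB]
  refine lintegral_mono_ae (ae_restrict_of_ae ?_)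
  filter_upwards [hpA] with ω hω
  rw [valueFormula_eq_sInf ht, ← weightedSq_mul (hr0 t ht).le]
  gcongr
  exact weightedSq_sInf_le_obj (hA t ht) hdm.nonneg hdp.nonneg _ hω

theorem setLIntegral_valueFormula_feedback (hMarkov : M.IsMarkov μ) (hM : M.IsNondegenerate μ)
    (hr0 : ∀ t < M.T, 0 < M.r0 (t + 1)) (hA : ∀ t < M.T, IsClosedCone (M.A t))
    {km kp : ℕ → (Fin Ns → ℝ) → (Fin N → ℝ)} (hk : M.IsMinimizer μ km kp) {t : ℕ}
    (ht : t < M.T) {y : Ω → ℝ} (hy : Measurable[ℱ t] y)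
    (hp : Measurable[ℱ t] fun ω => M.feedback km kp t (y ω) (M.state t ω)) {B : Set Ω}
    (hB : MeasurableSet[ℱ t] B) :
    ∫⁻ ω in B, ENNReal.ofReal (M.valueFormula μ t (y ω) (M.state t ω)) ∂μ =
      ∫⁻ ω in B, ENNReal.ofReal (M.valueFormula μ (t + 1) (M.r0 (t + 1) * y ω +
        M.ret (t + 1) ω ⬝ᵥ M.feedback km kp t (y ω) (M.state t ω)) (M.state (t + 1) ω)) ∂μ := by
  have hs : Measurable (M.state t) := (M.measurable_state t).mono (ℱ.le t) le_rfl
  rw [setLIntegral_valueFormula_succ hMarkov hM hA ht hy hp hB]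
  refine lintegral_congr_ae (ae_restrict_of_ae ?_)
  filter_upwards [ae_of_ae_map hs.aemeasurable (hk.minus t ht),
    ae_of_ae_map hs.aemeasurable (hk.plus t ht)] with ω h1 h2
  rw [objMinus_eq_obj] at h1
  rw [objPlus_eq_obj] at h2
  rw [valueFormula_eq_sInf ht, ← weightedSq_mul (hr0 t ht).le,
    weightedSq_sInf_eq_obj h1.1 h1.2 h2.1 h2.2]
  congr 3
  by_cases hy0 : y ω ≤ 0
  · rw [if_pos (mul_nonpos_of_nonneg_of_nonpos (hr0 t ht).le hy0), feedback, if_pos hy0,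
      if_neg (not_lt.2 hy0), add_zero, smul_neg, smul_smul, neg_smul]
  · have hy1 := not_le.1 hy0
    rw [if_neg (not_le.2 (mul_pos (hr0 t ht) hy1)), feedback, if_neg hy0, if_pos hy1, zero_add,
      smul_smul]

end FactorMarket

/-! ### Wealth, admissibility and verification over several periods -/

namespace FactorMarket

variable {Ω : Type*} {mΩ : MeasurableSpace Ω} {ℱ : Filtration ℕ mΩ} {N Ns Nε Nξ : ℕ}
  {M : FactorMarket ℱ N Ns Nε Nξ}

theorem wealth_self (t : ℕ) (Y : Ω → ℝ) (π : ℕ → Ω → (Fin N → ℝ)) : M.wealth t Y π t = Y := by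
  cases t with
  | zero => rfl
  | succ t => ext ω; simp [wealth]

theorem wealth_succ {t u : ℕ} (h : t ≤ u) (Y : Ω → ℝ) (π : ℕ → Ω → (Fin N → ℝ)) (ω : Ω) :
    M.wealth t Y π (u + 1) ω =
      M.r0 (u + 1) * M.wealth t Y π u ω + M.ret (u + 1) ω ⬝ᵥ π u ω := by
  simp [wealth, h]

theorem wealth_feedbackPolicy (km kp : ℕ → (Fin Ns → ℝ) → (Fin N → ℝ)) (t : ℕ) (Y : Ω → ℝ)
    (u : ℕ) : M.wealth t Y (M.feedbackPolicy km kp t Y) u = M.feedbackWealth km kp t Y u := by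
  induction u with
  | zero => rfl
  | succ u ih =>
    ext ω
    simp only [wealth, feedbackWealth, ih]
    rfl

theorem measurable_dotProduct_ret {u : ℕ} {p : Ω → Fin N → ℝ} (hp : Measurable[ℱ u] p) :
    Measurable[ℱ (u + 1)] fun ω => M.ret (u + 1) ω ⬝ᵥ p ω := by
  have h : Measurable fun q : (Fin N → ℝ) × (Fin N → ℝ) => q.1 ⬝ᵥ q.2 := by
    simp only [dotProduct]; fun_prop
  exact h.comp ((M.measurable_ret (u + 1)).prodMk (hp.mono (ℱ.mono u.le_succ) le_rfl))

theorem IsAdmissible.measurable_wealth {μ : Measure Ω} {t : ℕ} {π : ℕ → Ω → (Fin N → ℝ)}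
    (hπ : M.IsAdmissible μ t π) {Y : Ω → ℝ} (hY : Measurable[ℱ t] Y) {u : ℕ} (htu : t ≤ u)
    (hu : u ≤ M.T) : Measurable[ℱ u] (M.wealth t Y π u) := by
  induction u, htu using Nat.le_induction with
  | base => rwa [wealth_self]
  | succ u htu ih =>
    rw [funext (wealth_succ htu Y π)]
    exact (((ih (by omega)).mono (ℱ.mono u.le_succ) le_rfl).const_mul _).add
      (measurable_dotProduct_ret (hπ u htu hu).1)

theorem measurable_feedback {km kp : ℕ → (Fin Ns → ℝ) → (Fin N → ℝ)} {t : ℕ}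
    (hkm : Measurable (km t)) (hkp : Measurable (kp t)) :
    Measurable fun q : ℝ × (Fin Ns → ℝ) => M.feedback km kp t q.1 q.2 := by
  have h1 : Measurable fun q : ℝ × (Fin Ns → ℝ) => -(q.1 • km t q.2) :=
    (measurable_fst.smul (hkm.comp measurable_snd)).neg
  have h2 : Measurable fun q : ℝ × (Fin Ns → ℝ) => q.1 • kp t q.2 :=
    measurable_fst.smul (hkp.comp measurable_snd)
  exact ((h1.ite (measurableSet_le measurable_fst measurable_const) measurable_const).add
    (h2.ite (measurableSet_lt measurable_const measurable_fst) measurable_const)).const_smul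
      (M.r0 (t + 1))

theorem measurable_feedbackWealth {km kp : ℕ → (Fin Ns → ℝ) → (Fin N → ℝ)}
    (hkm : ∀ t < M.T, Measurable (km t)) (hkp : ∀ t < M.T, Measurable (kp t)) {t : ℕ} {Y : Ω → ℝ}
    (hY : Measurable[ℱ t] Y) {u : ℕ} (htu : t ≤ u) (hu : u ≤ M.T) :
    Measurable[ℱ u] (M.feedbackWealth km kp t Y u) := by
  induction u, htu using Nat.le_induction with
  | base => rwa [← wealth_feedbackPolicy, wealth_self]
  | succ u htu ih =>
    have ih' := ih (by omega)
    simp only [feedbackWealth, htu, if_true]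
    exact ((ih'.mono (ℱ.mono u.le_succ) le_rfl).const_mul _).add
      (measurable_dotProduct_ret ((measurable_feedback (hkm u hu) (hkp u hu)).comp
        (ih'.prodMk (M.measurable_state u))))

/-- For y ≠ 0 the position is a positive multiple of a minimizer; for y = 0 it is 0, which lies in
the cone by closedness. -/
theorem feedback_mem {km kp : ℕ → (Fin Ns → ℝ) → (Fin N → ℝ)} {t : ℕ} (hr : 0 < M.r0 (t + 1))
    (hA : IsClosedCone (M.A t)) {s : Fin Ns → ℝ} (hkm : km t s ∈ M.A t) (hkp : kp t s ∈ M.A t)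
    (y : ℝ) : M.feedback km kp t y s ∈ M.A t := by
  refine hA.smul_mem _ hr _ ?_
  rcases lt_trichotomy y 0 with hy | rfl | hy
  · rw [if_pos hy.le, if_neg hy.not_gt, add_zero, ← neg_smul]
    exact hA.smul_mem _ (neg_pos.2 hy) _ hkm
  · simpa using hA.zero_mem
  · rw [if_neg hy.not_ge, if_pos hy, zero_add]
    exact hA.smul_mem _ hy _ hkp

variable {μ : Measure Ω} [IsProbabilityMeasure μ]

theorem IsMinimizer.isAdmissible_feedbackPolicy {km kp : ℕ → (Fin Ns → ℝ) → (Fin N → ℝ)}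
    (hk : M.IsMinimizer μ km kp) (hr0 : ∀ t < M.T, 0 < M.r0 (t + 1))
    (hA : ∀ t < M.T, IsClosedCone (M.A t)) {t : ℕ} {Y : Ω → ℝ} (hY : Measurable[ℱ t] Y) :
    M.IsAdmissible μ t (M.feedbackPolicy km kp t Y) := by
  intro u htu hu
  have hs : Measurable (M.state u) := (M.measurable_state u).mono (ℱ.le u) le_rfl
  refine ⟨(measurable_feedback (hk.measurable_minus u hu) (hk.measurable_plus u hu)).comp
    ((measurable_feedbackWealth hk.measurable_minus hk.measurable_plus hY htu hu.le).prodMk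
      (M.measurable_state u)), ?_⟩
  filter_upwards [ae_of_ae_map hs.aemeasurable (hk.minus u hu),
    ae_of_ae_map hs.aemeasurable (hk.plus u hu)] with ω h1 h2
  exact feedback_mem (hr0 u hu) (hA u hu) h1.1 h2.1 _

theorem cost_eq_valueFormula (t : ℕ) (Y : Ω → ℝ) (π : ℕ → Ω → (Fin N → ℝ)) (ω : Ω) :
    M.cost t Y π ω =
      ENNReal.ofReal (M.valueFormula μ M.T (M.wealth t Y π M.T ω) (M.state M.T ω)) := by
  rw [valueFormula_terminal, cost]

/-- On the events of `ℱ t`, the value formula bounds the expected cost of admissible policies. -/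
theorem IsAdmissible.setLIntegral_valueFormula_le_cost (hMarkov : M.IsMarkov μ)
    (hM : M.IsNondegenerate μ) (hr0 : ∀ t < M.T, 0 < M.r0 (t + 1))
    (hA : ∀ t < M.T, IsClosedCone (M.A t)) {t : ℕ} (ht : t ≤ M.T) {Y : Ω → ℝ}
    (hY : Measurable[ℱ t] Y) {π : ℕ → Ω → (Fin N → ℝ)} (hπ : M.IsAdmissible μ t π) {B : Set Ω}
    (hB : MeasurableSet[ℱ t] B) :
    ∫⁻ ω in B, ENNReal.ofReal (M.valueFormula μ t (Y ω) (M.state t ω)) ∂μ ≤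
      ∫⁻ ω in B, M.cost t Y π ω ∂μ := by
  simp_rw [cost_eq_valueFormula (μ := μ)]
  -- Forward induction on u: B remains an event of `ℱ u`, so the one-step inequalities chain up to
  -- T.
  suffices h : ∀ u, t ≤ u → u ≤ M.T →
      ∫⁻ ω in B, ENNReal.ofReal (M.valueFormula μ t (Y ω) (M.state t ω)) ∂μ ≤
        ∫⁻ ω in B, ENNReal.ofReal
          (M.valueFormula μ u (M.wealth t Y π u ω) (M.state u ω)) ∂μ from h _ ht le_rfl
  intro u htu
  induction u, htu using Nat.le_induction with
  | base => intro _; rw [wealth_self]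
  | succ u htu ih =>
    intro hu
    refine (ih (by omega)).trans ?_
    simp_rw [wealth_succ htu]
    exact setLIntegral_valueFormula_le_succ hMarkov hM hr0 hA hu
      (hπ.measurable_wealth hY htu (by omega)) (hπ u htu hu).1 (hπ u htu hu).2 (ℱ.mono htu _ hB)

/-- On the events of `ℱ t`, the value formula is the expected cost of the feedback policy. -/
theorem IsMinimizer.setLIntegral_valueFormula_eq_cost
    {km kp : ℕ → (Fin Ns → ℝ) → (Fin N → ℝ)} (hk : M.IsMinimizer μ km kp)
    (hMarkov : M.IsMarkov μ) (hM : M.IsNondegenerate μ) (hr0 : ∀ t < M.T, 0 < M.r0 (t + 1))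
    (hA : ∀ t < M.T, IsClosedCone (M.A t)) {t : ℕ} (ht : t ≤ M.T) {Y : Ω → ℝ}
    (hY : Measurable[ℱ t] Y) {B : Set Ω} (hB : MeasurableSet[ℱ t] B) :
    ∫⁻ ω in B, ENNReal.ofReal (M.valueFormula μ t (Y ω) (M.state t ω)) ∂μ =
      ∫⁻ ω in B, M.cost t Y (M.feedbackPolicy km kp t Y) ω ∂μ := by
  have hπ := hk.isAdmissible_feedbackPolicy hr0 hA hY
  simp_rw [cost_eq_valueFormula (μ := μ)]
  suffices h : ∀ u, t ≤ u → u ≤ M.T →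
      ∫⁻ ω in B, ENNReal.ofReal (M.valueFormula μ t (Y ω) (M.state t ω)) ∂μ =
        ∫⁻ ω in B, ENNReal.ofReal (M.valueFormula μ u
          (M.wealth t Y (M.feedbackPolicy km kp t Y) u ω) (M.state u ω)) ∂μ from h _ ht le_rfl
  intro u htu
  induction u, htu using Nat.le_induction with
  | base => intro _; rw [wealth_self]
  | succ u htu ih =>
    intro hu
    refine (ih (by omega)).trans ?_
    simp_rw [wealth_succ htu, wealth_feedbackPolicy]
    exact setLIntegral_valueFormula_feedback hMarkov hM hr0 hA hk hu
      (measurable_feedbackWealth hk.measurable_minus hk.measurable_plus hY htu (by omega))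
      (hπ u htu hu).1 (ℱ.mono htu _ hB)

/-! ### From integrals over events to conditional expectations -/

/-- This is where the conditioning σ-algebra must contain σ(s_t): measurable versions of d^± are
evaluated at s_t. -/
theorem exists_measurable_valueFormula (hM : M.IsNondegenerate μ)
    (hA : ∀ t < M.T, IsClosedCone (M.A t)) {t : ℕ} (ht : t ≤ M.T) {m : MeasurableSpace Ω}
    (hsm : M.stateSigma t ≤ m) {Y : Ω → ℝ} (hY : Measurable[m] Y) :
    ∃ V : Ω → ℝ≥0∞, Measurable[m] V ∧
      (fun ω => ENNReal.ofReal (M.valueFormula μ t (Y ω) (M.state t ω))) =ᵐ[μ] V := by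
  obtain ⟨hdm, hdp⟩ := hM.isRegularWeight_dMinus_dPlus hA ht
  have hs : Measurable[mΩ] (M.state t) := (M.measurable_state t).mono (ℱ.le t) le_rfl
  have hs' : Measurable[m] (M.state t) := (comap_measurable (M.state t)).mono hsm le_rfl
  refine ⟨fun ω => ENNReal.ofReal (M.rho t ^ 2 * weightedSq
    (hdm.aemeasurable.mk _ (M.state t ω)) (hdp.aemeasurable.mk _ (M.state t ω)) (Y ω)), ?_, ?_⟩
  · exact ((measurable_weightedSq.comp ((hdm.aemeasurable.measurable_mk.comp hs').prodMk
      ((hdp.aemeasurable.measurable_mk.comp hs').prodMk hY))).const_mul _).ennreal_ofReal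
  · filter_upwards [ae_of_ae_map hs.aemeasurable hdm.aemeasurable.ae_eq_mk,
      ae_of_ae_map hs.aemeasurable hdp.aemeasurable.ae_eq_mk] with ω h1 h2
    rw [valueFormula_eq, h1, h2]

end FactorMarket

theorem ae_le_condLExp_of_forall_setLIntegral_le {Ω : Type*} {m mΩ : MeasurableSpace Ω}
    {μ : Measure[mΩ] Ω} [IsProbabilityMeasure μ] (hm : m ≤ mΩ) {V V' X : Ω → ℝ≥0∞}
    (hV' : Measurable[m] V') (hVV' : V =ᵐ[μ] V')
    (h : ∀ B, MeasurableSet[m] B → ∫⁻ ω in B, V ω ∂μ ≤ ∫⁻ ω in B, X ω ∂μ) :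
    V ≤ᵐ[μ] μ⁻[X | m] := by
  -- Two `m`-measurable functions are compared through their integrals over `m`-events, under the
  -- restriction of μ to `m`.
  refine hVV'.trans_le (ae_le_of_ae_le_trim (hm := hm) ?_)
  refine ae_le_of_forall_setLIntegral_le_of_sigmaFinite hV' fun B hB _ => ?_
  rw [setLIntegral_condLExp_trim hm _ _ hB, setLIntegral_trim hm hV' hB,
    setLIntegral_congr_fun_ae (hm B hB) (hVV'.symm.mono fun ω h _ => h)]
  exact h B hB

theorem ae_eq_condLExp_of_forall_setLIntegral_eq {Ω : Type*} {m mΩ : MeasurableSpace Ω}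
    {μ : Measure[mΩ] Ω} [IsProbabilityMeasure μ] (hm : m ≤ mΩ) {V V' X : Ω → ℝ≥0∞}
    (hV' : Measurable[m] V') (hVV' : V =ᵐ[μ] V')
    (h : ∀ B, MeasurableSet[m] B → ∫⁻ ω in B, V ω ∂μ = ∫⁻ ω in B, X ω ∂μ) :
    V =ᵐ[μ] μ⁻[X | m] := by
  refine hVV'.trans (ae_eq_condLExp hm μ X hV' fun B hB => ?_)
  rw [← h B hB]
  exact setLIntegral_congr_fun_ae (hm B hB) (hVV'.symm.mono fun ω h _ => h)

namespace FactorMarket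

variable {Ω : Type*} {mΩ : MeasurableSpace Ω} {ℱ : Filtration ℕ mΩ} {N Ns Nε Nξ : ℕ}
  {M : FactorMarket ℱ N Ns Nε Nξ} {μ : Measure Ω} [IsProbabilityMeasure μ]

theorem IsAdmissible.valueFormula_le_condLExp_cost (hMarkov : M.IsMarkov μ)
    (hM : M.IsNondegenerate μ) (hr0 : ∀ t < M.T, 0 < M.r0 (t + 1))
    (hA : ∀ t < M.T, IsClosedCone (M.A t)) {t : ℕ} (ht : t ≤ M.T) {m : MeasurableSpace Ω}
    (hsm : M.stateSigma t ≤ m) (hm : m ≤ ℱ t) {Y : Ω → ℝ} (hY : Measurable[m] Y)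
    {π : ℕ → Ω → (Fin N → ℝ)} (hπ : M.IsAdmissible μ t π) :
    (fun ω => ENNReal.ofReal (M.valueFormula μ t (Y ω) (M.state t ω))) ≤ᵐ[μ]
      μ⁻[M.cost t Y π | m] := by
  obtain ⟨V, hV, hVe⟩ := exists_measurable_valueFormula hM hA ht hsm hY
  exact ae_le_condLExp_of_forall_setLIntegral_le (hm.trans (ℱ.le t)) hV hVe fun B hB =>
    hπ.setLIntegral_valueFormula_le_cost hMarkov hM hr0 hA ht (hY.mono hm le_rfl) (hm B hB)

theorem IsMinimizer.valueFormula_eq_condLExp_cost {km kp : ℕ → (Fin Ns → ℝ) → (Fin N → ℝ)}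
    (hk : M.IsMinimizer μ km kp) (hMarkov : M.IsMarkov μ)
    (hM : M.IsNondegenerate μ) (hr0 : ∀ t < M.T, 0 < M.r0 (t + 1))
    (hA : ∀ t < M.T, IsClosedCone (M.A t)) {t : ℕ} (ht : t ≤ M.T) {m : MeasurableSpace Ω}
    (hsm : M.stateSigma t ≤ m) (hm : m ≤ ℱ t) {Y : Ω → ℝ} (hY : Measurable[m] Y) :
    (fun ω => ENNReal.ofReal (M.valueFormula μ t (Y ω) (M.state t ω))) =ᵐ[μ]
      μ⁻[M.cost t Y (M.feedbackPolicy km kp t Y) | m] := by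
  obtain ⟨V, hV, hVe⟩ := exists_measurable_valueFormula hM hA ht hsm hY
  exact ae_eq_condLExp_of_forall_setLIntegral_eq (hm.trans (ℱ.le t)) hV hVe fun B hB =>
    hk.setLIntegral_valueFormula_eq_cost hMarkov hM hr0 hA ht (hY.mono hm le_rfl) (hm B hB)

theorem IsMinimizer.solvesAuxiliary_feedbackPolicy {km kp : ℕ → (Fin Ns → ℝ) → (Fin N → ℝ)}
    (hk : M.IsMinimizer μ km kp) (hMarkov : M.IsMarkov μ)
    (hM : M.IsNondegenerate μ) (hr0 : ∀ t < M.T, 0 < M.r0 (t + 1))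
    (hA : ∀ t < M.T, IsClosedCone (M.A t)) (x0 lam b : ℝ) :
    M.SolvesAuxiliary μ x0 lam b (M.feedbackPolicy km kp 0 (M.initialShifted x0 lam b)) := by
  have hY : Measurable[ℱ 0] (M.initialShifted x0 lam b) := measurable_const
  refine ⟨hk.isAdmissible_feedbackPolicy hr0 hA hY, fun π' hπ' => ?_⟩
  -- The unconditional problem is the case t = 0, B = Ω of the integrated inequalities.
  have h1 := hk.setLIntegral_valueFormula_eq_cost hMarkov hM hr0 hA (Nat.zero_le _) hY
    (MeasurableSet.univ (m := ℱ 0))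
  have h2 := hπ'.setLIntegral_valueFormula_le_cost hMarkov hM hr0 hA (Nat.zero_le _) hY
    (MeasurableSet.univ (m := ℱ 0))
  rw [h1] at h2
  simpa only [Measure.restrict_univ] using h2

end FactorMarket

end ConeMV

end

theorem proposition1 {Ω : Type*} {mΩ : MeasurableSpace Ω} (μ : Measure Ω) [IsProbabilityMeasure μ]
    (ℱ : Filtration ℕ mΩ) {N Ns Nε Nξ : ℕ} (M : ConeMV.FactorMarket ℱ N Ns Nε Nξ)
    (hr0 : ∀ t < M.T, 0 < M.r0 (t + 1))
    (hA : ∀ t < M.T, ConeMV.IsClosedCone (M.A t))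
    (hMarkov : M.IsMarkov μ)
    (hCov : M.IsNondegenerate μ) :
    (∃ km kp : ℕ → (Fin Ns → ℝ) → (Fin N → ℝ), M.IsMinimizer μ km kp) ∧
    (∀ km kp : ℕ → (Fin Ns → ℝ) → (Fin N → ℝ), M.IsMinimizer μ km kp →
      (∀ x0 lam b : ℝ, M.SolvesAuxiliary μ x0 lam b
        (M.feedbackPolicy km kp 0 (M.initialShifted x0 lam b))) ∧
      (∀ t < M.T, ∀ m : MeasurableSpace Ω, M.stateSigma t ≤ m → m ≤ ℱ t →
        ∀ Y : Ω → ℝ, Measurable[m] Y →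
          M.SolvesTruncated μ t m Y (M.feedbackPolicy km kp t Y))) ∧
    (∀ t < M.T, ∀ m : MeasurableSpace Ω, M.stateSigma t ≤ m → m ≤ ℱ t →
      ∀ Y : Ω → ℝ, Measurable[m] Y →
        M.IsTruncatedValue μ t m Y (fun ω => M.valueFormula μ t (Y ω) (M.state t ω))) := by
  refine ⟨hCov.exists_isMinimizer hA, fun km kp hk =>
    ⟨hk.solvesAuxiliary_feedbackPolicy hMarkov hCov hr0 hA, fun t ht m hsm hm Y hY =>
      ⟨hk.isAdmissible_feedbackPolicy hr0 hA (hY.mono hm le_rfl), fun π hπ => ?_⟩⟩,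
    fun t ht m hsm hm Y hY => ⟨fun π hπ => ?_, ?_⟩⟩
  · exact (hk.valueFormula_eq_condLExp_cost hMarkov hCov hr0 hA ht.le hsm hm hY).symm.trans_le
      (hπ.valueFormula_le_condLExp_cost hMarkov hCov hr0 hA ht.le hsm hm hY)
  · exact hπ.valueFormula_le_condLExp_cost hMarkov hCov hr0 hA ht.le hsm hm hY
  · obtain ⟨km, kp, hk⟩ := hCov.exists_isMinimizer hA
    exact ⟨_, hk.isAdmissible_feedbackPolicy hr0 hA (hY.mono hm le_rfl),
      hk.valueFormula_eq_condLExp_cost hMarkov hCov hr0 hA ht.le hsm hm hY⟩
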